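/- Let $N,n\ge 1$ be integers, let $S\in\mathbb R^{n\times n}$ be semi-simple (diagonalizable over $\mathbb C$) with all eigenvalues having zero real part, let $t_0\in\mathbb R$, and let $\mu_1>0$, $\alpha_1>0$, $\alpha_2>1$, $\alpha_3>1$. For each dimension $l\in\{1,\dots,n\}$ let $\tilde A^l(t)=[\tilde a^l_{ij}(t)]\in\mathbb R^{N\times N}$, $t\ge t_0$, be a nonnegative, bounded, piecewise continuous (finitely many discontinuities in each bounded interval, finite one-sided limits) weighted adjacency matrix, where $\tilde a^l_{ij}(t)$ is the weight with which agent $i$ receives information from agent $j$. Suppose that there is $\kappa>0$ such that for all $l$ and all $t\ge t_0$ the digraph formed by the edges of weight $\tilde a^l_{ij}(t)\ge\kappa$ contains a directed spanning tree. (For $0/1$ adjacency matrices, with $\kappa=1$, this says that the graph $\tilde{\mathcal G}^l(t)$ with adjacency matrix $\tilde A^l(t)$ contains a directed spanning tree for all $t\ge t_0$.) Each agent $i\in\{1,\dots,N\}$ has a continuous observer state $\eta_i:[t_0,\infty)\to\mathbb R^n$ and triggering instants $t^i_0=t_0$, $$t^i_{k+1}=\inf\Big\{t>t^i_k\ \Big|\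 \big\|e^{S(t-t^i_k)}\eta_i(t^i_k)-\eta_i(t)\big\|-\frac{\alpha_1}{(t-t_0+\alpha_2)^{\alpha_3}}\ge 0\Big\}$$ with the Euclidean norm and $\inf\emptyset=\infty$ (no further triggering). Put $\mathcal W_i(t)=e^{-St}\eta_i(t)$ and $\hat{\mathcal W}_i(t)=e^{-St}\hat\eta_i(t)$, where $\hat\eta_i(t)=e^{S(t-t^i_k)}\eta_i(t^i_k)$ and $t^i_k$ is the latest triggering instant of agent $i$ not after $t$. Let $T^*=\min_i\sup_k t^i_k\in(t_0,\infty]$ be the first accumulation instant of triggering instants ($T^*<\infty$ means Zeno behaviour), and suppose that for every $i$, and every $t\in(t_0,T^*)$ that is not a triggering instant of any agent and at which all $\tilde a^l_{jm}$ are continuous, $$\dot{\mathcal W}_i(t)=-\mu_1\sum_{j=1}^N\tilde a_{ij}(t)\circ\big(\hat{\mathcal W}_i(t)-\hat{\mathcal W}_j(t)\big),\qquad \tilde a_{ij}(t)=[\tilde a^1_{ij}(t),\dots,\tilde a^n_{ij}(t)]^T,$$ where $\circ$ is the entrywise product. Then: 1. There is no Zeno behaviour: $T^*=\infty$, and there is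 $\varrho>0$ such that $t^i_{k+1}-t^i_k\ge\varrho$ for all $i$ and all $k$ with $t_k^i<\infty$. 2. The observer states converge to the same value: $\eta_i(t)-\eta_j(t)\to0$ as $t\to\infty$ for all $i,j$. More precisely, there is $w\in\mathbb R^n$ such that for all $i$, as $t\to\infty$, $\mathcal W_i(t)\to w$ and $\eta_i(t)-e^{St}w\to0$. -/

import Mathlib

open Set Filter Topology

noncomputable section

/-- `G` contains a directed spanning tree. An edge `G.Adj i j` means that `i` receives information
from `j`. The tree is given by its root `r` and its parent map `p`: every vertex other than the
root receives from its parent, and following parents leads from every vertex to the root. -/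
def ContainsDirectedSpanningTree {V : Type*} (G : Digraph V) : Prop :=
  ∃ (r : V) (p : V → V), (∀ i, i ≠ r → G.Adj i (p i)) ∧ ∀ i, ∃ m : ℕ, p^[m] i = r

/-- The digraph of the edges of weight at least `κ` in a weighted adjacency matrix `A`
(`A i j` is the weight with which `i` receives from `j`). If `A` has entries in `{0, 1}` and
`κ = 1`, this is the digraph with adjacency matrix `A`. -/
def edgesOfWeight {N : ℕ} (κ : ℝ) (A : Matrix (Fin N) (Fin N) ℝ) : Digraph (Fin N) where
  Adj i j := κ ≤ A i j

/-- `f` is piecewise continuous on `[t₀, ∞)`: continuous off a set with finitely many points in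
each bounded interval, with finite one-sided limits everywhere. -/
def PiecewiseContinuousFrom (t₀ : ℝ) (f : ℝ → ℝ) : Prop :=
  (∃ D : Set ℝ, (∀ T : ℝ, (D ∩ Icc t₀ T).Finite) ∧
    ∀ t, t₀ ≤ t → t ∉ D → ContinuousWithinAt f (Ici t₀) t) ∧
  (∀ t, t₀ ≤ t → ∃ y, Tendsto f (𝓝[>] t) (𝓝 y)) ∧
  (∀ t, t₀ < t → ∃ y, Tendsto f (𝓝[<] t) (𝓝 y))

/-- `S` is semi-simple (diagonalizable over `ℂ`) and all its complex eigenvalues have zero real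
part. -/
def IsSemisimpleWithImaginarySpectrum {n : ℕ} (S : Matrix (Fin n) (Fin n) ℝ) : Prop :=
  Module.End.IsSemisimple (Matrix.toLin' (S.map Complex.ofReal)) ∧
    ∀ z ∈ spectrum ℂ (S.map Complex.ofReal), z.re = 0

/-- The matrix exponential `e^{St}`, acting on `ℝⁿ` with the Euclidean norm. -/
def expFlow {n : ℕ} (S : Matrix (Fin n) (Fin n) ℝ) (t : ℝ) :
    EuclideanSpace ℝ (Fin n) →L[ℝ] EuclideanSpace ℝ (Fin n) :=
  NormedSpace.exp (t • Matrix.toEuclideanCLM (n := Fin n) (𝕜 := ℝ) S)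

/-- The latest instant `≤ t` in the sequence `τ` of triggering instants of an agent
(the value `⊤` in `τ` stands for "no further triggering"). -/
def lastTrigger (τ : ℕ → EReal) (t : ℝ) : ℝ :=
  sSup {s : ℝ | s ≤ t ∧ ∃ k, τ k = (s : EReal)}

/-- The open-loop estimate `e^{S(t-s)} x(s)` at time `t` from the sample taken at time `s`. -/
def openLoop {n : ℕ} (S : Matrix (Fin n) (Fin n) ℝ) (x : ℝ → EuclideanSpace ℝ (Fin n))
    (s t : ℝ) : EuclideanSpace ℝ (Fin n) :=
  expFlow S (t - s) (x s)

/-- The auxiliary variable `W(t) = e^{-St} x(t)`. -/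
def auxVar {n : ℕ} (S : Matrix (Fin n) (Fin n) ℝ) (x : ℝ → EuclideanSpace ℝ (Fin n))
    (t : ℝ) : EuclideanSpace ℝ (Fin n) :=
  expFlow S (-t) (x t)

/-- The auxiliary variable `Ŵ(t) = e^{-St} x̂(t)` of the open-loop estimate
`x̂(t) = e^{S(t-s)} x(s)`, where `s` is the latest triggering instant. -/
def auxVarHat {n : ℕ} (S : Matrix (Fin n) (Fin n) ℝ) (τ : ℕ → EReal)
    (x : ℝ → EuclideanSpace ℝ (Fin n)) (t : ℝ) : EuclideanSpace ℝ (Fin n) :=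
  auxVar S (openLoop S x (lastTrigger τ t)) t

/-- The first accumulation instant `min_i sup_k t_k^i` of triggering instants. It is `⊤` exactly
if the triggering instants of no agent accumulate at a finite time. -/
def accumulationTime {N : ℕ} (τ : Fin N → ℕ → EReal) : EReal :=
  ⨅ i, ⨆ k, τ i k

/-- `η i` (observer states) and `τ i k` (the `k`-th triggering instant `t_k^i` of agent `i`, or `⊤`
if there is none) form a trajectory of the event-triggered observer started at time `t₀`, where
`a l t i j` is the entry `(i, j)` of the adjacency matrix for the dimension `l` at time `t`.
The differential equation is required only before the first accumulation instant of triggering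
instants, where the latest triggering instant makes sense: Zeno behaviour is not excluded here. -/
structure IsEventTriggeredObserver {N n : ℕ} (S : Matrix (Fin n) (Fin n) ℝ)
    (μ₁ α₁ α₂ α₃ t₀ : ℝ) (a : Fin n → ℝ → Matrix (Fin N) (Fin N) ℝ)
    (η : Fin N → ℝ → EuclideanSpace ℝ (Fin n)) (τ : Fin N → ℕ → EReal) : Prop where
  continuousOn : ∀ i, ContinuousOn (η i) (Ici t₀)
  first_trigger : ∀ i, τ i 0 = (t₀ : EReal)
  next_trigger : ∀ i k, τ i (k + 1) =
    sInf ((fun t : ℝ => (t : EReal)) '' {t : ℝ | τ i k < (t : EReal) ∧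
      0 ≤ ‖openLoop S (η i) (τ i k).toReal t - η i t‖ - α₁ / (t - t₀ + α₂) ^ α₃})
  dynamics : ∀ i (t : ℝ), t₀ < t → (t : EReal) < accumulationTime τ →
    (∀ j k, τ j k ≠ (t : EReal)) → (∀ l j m, ContinuousAt (fun s => a l s j m) t) →
    HasDerivAt (auxVar S (η i))
      (-μ₁ • ∑ j, WithLp.toLp 2 (fun l =>
        a l t i j * (auxVarHat S (τ i) (η i) t l - auxVarHat S (τ j) (η j) t l))) t

end

/-!
In the coordinates `W_i(t) = e^{-St} η_i(t)` each dimension is a scalar consensus system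
`x_i' = ∑_j b_ij (x_j - x_i) + g_i`, where the perturbation `g_i` comes from sampling. As the flow
`e^{St}` is bounded (`exists_norm_expFlow_le`), `g_i` is at most a constant times the triggering
threshold, that is, times `θ(t) = (t - t₀ + α₂)^{-α₃}`, as long as triggering instants have not
accumulated (`IsEventTriggeredObserver.norm_auxVarHat_sub_le`).

The spread `max_i x_i - min_i x_i` contracts on each window of length one by a fixed factor, up to
the size of the perturbation (`exists_spread_contraction`). The spanning tree may change with time
in an arbitrary way, but there are finitely many trees, so one of them has an integrated weight
bounded below over the window (`exists_tree_of_window`). If the root of this tree starts in the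
lower half of the range of values, the positive quantities `hi - x_i` spread from the root along the
tree, by iterated integration (`lift_along_tree`), which lowers the maximum; if it starts in the
upper half, the minimum is raised.

Since `θ` decays more slowly than any exponential, the contraction makes the spread decay at least
as fast as `θ` (`exists_spread_le_mul`), and so does the speed of `W_i`
(`IsEventTriggeredObserver.exists_decay_bounds`). Between two triggering instants the sampling error
thus grows at a speed comparable with the threshold it has to reach, which takes a time bounded
below by some `ϱ > 0`. This holds up to the first accumulation instant `T*`, with constants that do
not depend on the triggering instants, and hence `T* = ∞`. Finally `θ` is integrable because
`α₃ > 1`, so every `W_i` converges, and the limits agree because the spread vanishes.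

The differential equation holds only off the countable set of triggering instants and
discontinuities; `le_of_forall_slope_le_off_countable` is what makes this harmless.
-/

noncomputable section

/-! ### Growth of continuous functions with a countable exceptional set -/

/-- A continuous function whose upper right slopes are nonpositive off a countable set does not
increase. The exceptional set is avoided by choosing a level which the function, tilted slightly
downwards, does not attain on it, and looking at the last point at which that level is attained. -/
theorem le_of_forall_slope_le_off_countable {f : ℝ → ℝ} {a b : ℝ} (hab : a ≤ b)
    (hf : ContinuousOn f (Icc a b)) {D : Set ℝ} (hD : D.Countable)
    (h : ∀ x ∈ Ioo a b, x ∉ D → ∀ ε > 0, ∀ᶠ z in 𝓝[>] x, f z ≤ f x + ε * (z - x)) :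
    f b ≤ f a := by
  by_contra! hlt
  have hab' : a < b := lt_of_le_of_ne hab (by rintro rfl; exact lt_irrefl _ hlt)
  obtain ⟨ε, hε, hεb⟩ : ∃ ε > 0, f a < f b - ε * (b - a) := by
    refine ⟨(f b - f a) / (2 * (b - a)), by
      have := sub_pos.2 hlt; have := sub_pos.2 hab'; positivity, ?_⟩
    have : (f b - f a) / (2 * (b - a)) * (b - a) = (f b - f a) / 2 := by
      have := (sub_pos.2 hab').ne'
      field_simp
    linarith
  set g : ℝ → ℝ := fun x => f x - ε * (x - a) with hg
  have hgc : ContinuousOn g (Icc a b) := by fun_prop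
  have hgab : g a < g b := by simpa [hg] using hεb
  -- a level `y` that `g` does not attain on the exceptional set
  obtain ⟨y, hyD, hya, hyb⟩ :=
    (((hD.insert a).image g).dense_compl ℝ).exists_between hgab
  obtain ⟨x, ⟨⟨hxI, hxy⟩, hxmax⟩⟩ :=
    (isCompact_Icc.of_isClosed_subset
      (hgc.preimage_isClosed_of_isClosed isClosed_Icc (isClosed_Iic (a := y)))
      inter_subset_left).exists_isGreatest ⟨a, left_mem_Icc.2 hab, hya.le⟩
  have hxy : g x ≤ y := hxy
  have hxb : x < b := lt_of_le_of_ne hxI.2 (by rintro rfl; exact absurd hyb hxy.not_gt)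
  have hbig : ∀ᶠ z in 𝓝[>] x, y < g z := by
    filter_upwards [Ioo_mem_nhdsGT hxb] with z hz
    by_contra! hle
    exact absurd (hxmax ⟨⟨hxI.1.trans hz.1.le, hz.2.le⟩, hle⟩) hz.1.not_ge
  have hgx : g x = y := by
    refine hxy.antisymm (ge_of_tendsto (x := 𝓝[>] x) (f := g) ?_ (hbig.mono fun _ h => h.le))
    exact ((hgc x hxI).mono_of_mem_nhdsWithin
      (mem_of_superset (Ioo_mem_nhdsGT hxb) fun z hz => ⟨hxI.1.trans hz.1.le, hz.2.le⟩))
  have hxD : x ∉ insert a D := fun hx => hyD ⟨x, hx, hgx⟩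
  have hxa : a < x := lt_of_le_of_ne hxI.1 fun h => hxD (Or.inl h.symm)
  obtain ⟨z, hz1, hz2, hz3⟩ := ((h x ⟨hxa, hxb⟩ (fun hx => hxD (Or.inr hx)) ε hε).and
    (hbig.and self_mem_nhdsWithin)).exists
  have hz3 : x < z := hz3
  simp only [hg] at hz2 hgx
  nlinarith

theorem HasDerivAt.eventually_le_add_mul {f : ℝ → ℝ} {f' x c : ℝ} (h : HasDerivAt f f' x)
    (hc : f' < c) : ∀ᶠ z in 𝓝[>] x, f z ≤ f x + c * (z - x) := by
  have h1 : ∀ᶠ z in 𝓝[≠] x, slope f x z < c :=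
    (hasDerivAt_iff_tendsto_slope.1 h).eventually_lt_const hc
  have h2 : ∀ᶠ z in 𝓝[>] x, slope f x z < c :=
    h1.filter_mono (nhdsWithin_mono _ fun z (hz : x < z) => hz.ne')
  filter_upwards [h2, self_mem_nhdsWithin] with z hz (hxz : x < z)
  rw [slope_def_field, div_lt_iff₀ (sub_pos.2 hxz)] at hz
  linarith

theorem le_of_hasDerivAt_nonneg_off_countable {f f' : ℝ → ℝ} {a b : ℝ} (hab : a ≤ b)
    (hf : ContinuousOn f (Icc a b)) {D : Set ℝ} (hD : D.Countable)
    (h : ∀ x ∈ Ioo a b, x ∉ D → HasDerivAt f (f' x) x) (h' : ∀ x ∈ Ioo a b, x ∉ D → 0 ≤ f' x) :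
    f a ≤ f b := by
  have := le_of_forall_slope_le_off_countable (f := fun x => - f x) hab hf.neg hD
    fun x hx hxD ε hε => (h x hx hxD).neg.eventually_le_add_mul (by linarith [h' x hx hxD])
  simpa using this

theorem abs_sub_le_sub_of_hasDerivAt_off_countable {f f' g g' : ℝ → ℝ} {a b : ℝ} (hab : a ≤ b)
    (hf : ContinuousOn f (Icc a b)) (hg : ContinuousOn g (Icc a b)) {D : Set ℝ}
    (hD : D.Countable) (h : ∀ x ∈ Ioo a b, x ∉ D → HasDerivAt f (f' x) x)
    (hg' : ∀ x ∈ Ioo a b, x ∉ D → HasDerivAt g (g' x) x)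
    (h' : ∀ x ∈ Ioo a b, x ∉ D → |f' x| ≤ g' x) : |f b - f a| ≤ g b - g a := by
  have h1 := le_of_hasDerivAt_nonneg_off_countable (f := fun x => g x - f x) hab
    (hg.sub hf) hD (fun x hx hxD => (hg' x hx hxD).sub (h x hx hxD))
    (fun x hx hxD => by linarith [abs_le.1 (h' x hx hxD)])
  have h2 := le_of_hasDerivAt_nonneg_off_countable (f := fun x => g x + f x) hab
    (hg.add hf) hD (fun x hx hxD => (hg' x hx hxD).add (h x hx hxD))
    (fun x hx hxD => by linarith [abs_le.1 (h' x hx hxD)])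
  rw [abs_le]
  constructor <;> linarith

theorem abs_sub_le_of_hasDerivAt_off_countable {f f' : ℝ → ℝ} {a b C : ℝ} (hab : a ≤ b)
    (hf : ContinuousOn f (Icc a b)) {D : Set ℝ} (hD : D.Countable)
    (h : ∀ x ∈ Ioo a b, x ∉ D → HasDerivAt f (f' x) x)
    (h' : ∀ x ∈ Ioo a b, x ∉ D → |f' x| ≤ C) : |f b - f a| ≤ C * (b - a) := by
  rw [mul_sub]
  exact abs_sub_le_sub_of_hasDerivAt_off_countable (g := fun x => C * x) hab hf
    (Continuous.continuousOn (by fun_prop)) hD h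
    (fun x _ _ => by simpa using (hasDerivAt_id x).const_mul C) h'

/-! ### Consensus dynamics on one window -/

/-- Maximum principle: the largest coordinate of a subsolution does not increase. -/
theorem le_of_subsolution {ι : Type*} [Fintype ι] {y y' : ι → ℝ → ℝ} {B : ℝ → ι → ι → ℝ}
    {a b P : ℝ} (hab : a ≤ b) (hy : ∀ i, ContinuousOn (y i) (Icc a b)) {D : Set ℝ}
    (hD : D.Countable) (hd : ∀ t ∈ Ioo a b, t ∉ D → ∀ i, HasDerivAt (y i) (y' i t) t)
    (hB : ∀ t ∈ Ioo a b, ∀ i j, 0 ≤ B t i j)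
    (hle : ∀ t ∈ Ioo a b, t ∉ D → ∀ i, y' i t ≤ ∑ j, B t i j * (y j t - y i t))
    (hP : ∀ i, y i a ≤ P) (i : ι) : y i b ≤ P := by
  have hne : (Finset.univ : Finset ι).Nonempty := ⟨i, Finset.mem_univ i⟩
  set f : ℝ → ℝ := fun t => Finset.univ.sup' hne fun i => y i t with hf
  have hyf : ∀ j t, y j t ≤ f t := fun j t =>
    Finset.le_sup' (f := fun i => y i t) (Finset.mem_univ j)
  have key : f b ≤ f a := by
    refine le_of_forall_slope_le_off_countable hab
      (ContinuousOn.finset_sup'_apply hne fun i _ => hy i) hD ?_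
    intro x hx hxD ε hε
    have hall : ∀ j, ∀ᶠ z in 𝓝[>] x, y j z ≤ f x + ε * (z - x) := by
      intro j
      rcases (hyf j x).eq_or_lt with hj | hj
      · rw [← hj]
        refine (hd x hx hxD j).eventually_le_add_mul (lt_of_le_of_lt ?_ hε)
        refine (hle x hx hxD j).trans (Finset.sum_nonpos fun k _ => ?_)
        exact mul_nonpos_of_nonneg_of_nonpos (hB x hx j k) (by linarith [hyf k x])
      · have : ∀ᶠ z in 𝓝[>] x, y j z < f x :=
          ((hd x hx hxD j).continuousAt.eventually_lt_const hj).filter_mono nhdsWithin_le_nhds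
        filter_upwards [this, self_mem_nhdsWithin] with z hz (hxz : x < z)
        nlinarith
    filter_upwards [eventually_all.2 hall] with z hz
    exact Finset.sup'_le _ _ fun j _ => hz j
  exact (hyf i b).trans (key.trans (Finset.sup'_le _ _ fun j _ => hP j))

/-- The maximum principle with a perturbation of size `G`, which can lift the largest coordinate at
speed at most `G`. -/
theorem le_add_of_perturbed_subsolution {ι : Type*} [Fintype ι] {x x' : ι → ℝ → ℝ}
    {B : ℝ → ι → ι → ℝ} {a b G hi : ℝ} (hab : a ≤ b) (hx : ∀ i, ContinuousOn (x i) (Icc a b))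
    {D : Set ℝ} (hD : D.Countable)
    (hd : ∀ t ∈ Ioo a b, t ∉ D → ∀ i, HasDerivAt (x i) (x' i t) t)
    (hB : ∀ t ∈ Ioo a b, ∀ i j, 0 ≤ B t i j)
    (hle : ∀ t ∈ Ioo a b, t ∉ D → ∀ i, x' i t ≤ ∑ j, B t i j * (x j t - x i t) + G)
    (hhi : ∀ i, x i a ≤ hi) (i : ι) : x i b ≤ hi + G * (b - a) := by
  have := le_of_subsolution (y := fun i t => x i t - G * (t - a)) (y' := fun i t => x' i t - G)
    (P := hi) hab (fun i => (hx i).sub (Continuous.continuousOn (by fun_prop))) hD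
    (fun t ht htD i => (hd t ht htD i).sub
      (by simpa using ((hasDerivAt_id t).sub_const a).const_mul G)) hB
    (fun t ht htD i => by
      simp only [sub_sub_sub_cancel_right]
      linarith [hle t ht htD i])
    (fun i => by simpa using hhi i) i
  linarith

/-- Positivity spreads from the root along a tree with parent map `p`. If along the tree all
weights are at least `φ' = q`, an agent from which `m` steps lead to the root is lifted at least by
the `m`-fold iterated integral `φ ^ m / m!`; the factor `exp (β (t - a))` absorbs the outflow. -/
theorem lift_along_tree {ι : Type*} [Fintype ι] {u u' : ι → ℝ → ℝ} {B : ℝ → ι → ι → ℝ}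
    {a b β v₀ : ℝ} (hu : ∀ i, ContinuousOn (u i) (Icc a b)) {D : Set ℝ} (hD : D.Countable)
    (hd : ∀ t ∈ Ioo a b, t ∉ D → ∀ i, HasDerivAt (u i) (u' i t) t)
    (hB : ∀ t ∈ Ioo a b, ∀ i j, 0 ≤ B t i j) (hβ : ∀ t ∈ Ioo a b, ∀ i, ∑ j, B t i j ≤ β)
    (hge : ∀ t ∈ Ioo a b, t ∉ D → ∀ i, ∑ j, B t i j * (u j t - u i t) ≤ u' i t)
    (hpos : ∀ t ∈ Icc a b, ∀ i, 0 ≤ u i t)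
    {r : ι} {p : ι → ι} {φ q : ℝ → ℝ} (hφ : ContinuousOn φ (Icc a b)) (hφa : φ a = 0)
    (hφ0 : ∀ t ∈ Icc a b, 0 ≤ φ t) (hφ1 : ∀ t ∈ Icc a b, φ t ≤ 1)
    (hφd : ∀ t ∈ Ioo a b, t ∉ D → HasDerivAt φ (q t) t)
    (hq0 : ∀ t ∈ Ioo a b, 0 ≤ q t)
    (hq : ∀ t ∈ Ioo a b, ∀ i, i ≠ r → q t ≤ B t i (p i))
    (hv₀ : 0 ≤ v₀) (hr : v₀ ≤ u r a) (m : ℕ) :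
    ∀ i, p^[m] i = r → ∀ t ∈ Icc a b,
      v₀ * (φ t ^ m / m.factorial) ≤ Real.exp (β * (t - a)) * u i t := by
  have hvc : ∀ i, ContinuousOn (fun t => Real.exp (β * (t - a)) * u i t) (Icc a b) := fun i =>
    (Continuous.continuousOn (by fun_prop)).mul (hu i)
  have hvd : ∀ t ∈ Ioo a b, t ∉ D → ∀ i, HasDerivAt (fun t => Real.exp (β * (t - a)) * u i t)
      (Real.exp (β * (t - a)) * β * u i t + Real.exp (β * (t - a)) * u' i t) t := by
    intro t ht htD i
    have h1 : HasDerivAt (fun t => β * (t - a)) β t := by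
      simpa using ((hasDerivAt_id t).sub_const a).const_mul β
    exact h1.exp.mul (hd t ht htD i)
  have hv' : ∀ t ∈ Ioo a b, t ∉ D → ∀ i j, B t i j * (Real.exp (β * (t - a)) * u j t) ≤
      Real.exp (β * (t - a)) * β * u i t + Real.exp (β * (t - a)) * u' i t := by
    intro t ht htD i j
    have htI := Ioo_subset_Icc_self ht
    have h1 : B t i j * u j t ≤ ∑ k, B t i k * u k t :=
      Finset.single_le_sum (f := fun k => B t i k * u k t)
        (fun k _ => mul_nonneg (hB t ht i k) (hpos t htI k)) (Finset.mem_univ j)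
    have h2 : (∑ k, B t i k) * u i t ≤ β * u i t :=
      mul_le_mul_of_nonneg_right (hβ t ht i) (hpos t htI i)
    have h3 := hge t ht htD i
    simp only [mul_sub, Finset.sum_sub_distrib, ← Finset.sum_mul] at h3
    have h4 : B t i j * u j t ≤ β * u i t + u' i t := by linarith
    have := mul_le_mul_of_nonneg_left h4 (Real.exp_pos (β * (t - a))).le
    linarith
  have hroot : ∀ t ∈ Icc a b, v₀ ≤ Real.exp (β * (t - a)) * u r t := by
    intro t ht
    have hsub : Ioo a t ⊆ Ioo a b := Ioo_subset_Ioo_right ht.2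
    have := le_of_hasDerivAt_nonneg_off_countable ht.1
      ((hvc r).mono (Icc_subset_Icc_right ht.2)) hD
      (fun x hx hxD => hvd x (hsub hx) hxD r) (fun x hx hxD =>
        le_trans (mul_nonneg (hB x (hsub hx) r r) (mul_nonneg (Real.exp_pos _).le
          (hpos x (Ioo_subset_Icc_self (hsub hx)) r))) (hv' x (hsub hx) hxD r r))
    simp only [sub_self, mul_zero, Real.exp_zero, one_mul] at this
    linarith
  induction m with
  | zero =>
    intro i hi t ht
    obtain rfl : i = r := hi
    simpa using hroot t ht
  | succ m ih =>
    intro i hi t ht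
    by_cases hir : i = r
    · subst hir
      refine le_trans ?_ (hroot t ht)
      have h1 : φ t ^ (m + 1) ≤ 1 := pow_le_one₀ (hφ0 t ht) (hφ1 t ht)
      have h2 : (1 : ℝ) ≤ (m + 1).factorial := by
        exact_mod_cast Nat.succ_le_of_lt (Nat.factorial_pos (m + 1))
      exact mul_le_of_le_one_right hv₀ ((div_le_one (by linarith)).2 (h1.trans h2))
    · have hsub : Ioo a t ⊆ Ioo a b := Ioo_subset_Ioo_right ht.2
      have hfac : ((m + 1).factorial : ℝ) = (m + 1) * m.factorial := by
        push_cast [Nat.factorial_succ]; ring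
      have hm0 : (m.factorial : ℝ) ≠ 0 := by exact_mod_cast Nat.factorial_ne_zero m
      have hm1 : (m + 1 : ℝ) ≠ 0 := by positivity
      -- with `v = exp (β (t - a)) u`, the difference of the two sides has derivative at least
      -- `B t i (p i) * v (p i) - v₀ * (φ' φ ^ m / m!)`, nonnegative by the induction hypothesis
      have := le_of_hasDerivAt_nonneg_off_countable
        (f := fun t => Real.exp (β * (t - a)) * u i t -
          v₀ * (φ t ^ (m + 1) / (m + 1).factorial)) ht.1
        (((hvc i).sub (continuousOn_const.mul ((hφ.pow _).div_const _))).mono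
          (Icc_subset_Icc_right ht.2)) hD
        (fun x hx hxD => (hvd x (hsub hx) hxD i).sub
          ((((hφd x (hsub hx) hxD).fun_pow (m + 1)).div_const _).const_mul v₀))
        (fun x hx hxD => by
          have hx' := hsub hx
          have h1 := hv' x hx' hxD i (p i)
          have h2 := ih (p i) hi x (Ioo_subset_Icc_self hx')
          have h3 := mul_le_mul_of_nonneg_left h2 (hq0 x hx')
          have h4 : q x * (Real.exp (β * (x - a)) * u (p i) x) ≤
              B x i (p i) * (Real.exp (β * (x - a)) * u (p i) x) :=
            mul_le_mul_of_nonneg_right (hq x hx' i hir)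
              (mul_nonneg (Real.exp_pos _).le (hpos x (Ioo_subset_Icc_self hx') _))
          have h5 : v₀ * ((((m + 1 : ℕ) : ℝ) * φ x ^ (m + 1 - 1) * q x) / (m + 1).factorial) =
              q x * (v₀ * (φ x ^ m / m.factorial)) := by
            rw [hfac]; push_cast; field_simp
          rw [h5]
          linarith)
      rw [hφa] at this
      have h0 : 0 ≤ Real.exp (β * (a - a)) * u i a :=
        mul_nonneg (Real.exp_pos _).le (hpos a ⟨le_rfl, ht.1.trans ht.2⟩ i)
      have h1 : v₀ * ((0 : ℝ) ^ (m + 1) / (m + 1).factorial) = 0 := by simp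
      linarith

/-- If the root of a tree starts a gap `v₀` below the upper bound `hi`, then by the end of
the window every agent is pulled below `hi + G`, where `G` bounds the perturbation, by a multiple of
`v₀`. The proof absorbs the perturbation by adding `G (s + 1 - t)` to the solution. -/
theorem upper_bound_of_tree {ι : Type*} [Fintype ι] {x x' : ι → ℝ → ℝ} {B : ℝ → ι → ι → ℝ}
    {s β G hi v₀ : ℝ} (hx : ∀ i, ContinuousOn (x i) (Icc s (s + 1))) {D : Set ℝ}
    (hD : D.Countable) (hd : ∀ t ∈ Ioo s (s + 1), t ∉ D → ∀ i, HasDerivAt (x i) (x' i t) t)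
    (hB : ∀ t ∈ Ioo s (s + 1), ∀ i j, 0 ≤ B t i j)
    (hβ : ∀ t ∈ Ioo s (s + 1), ∀ i, ∑ j, B t i j ≤ β)
    (hle : ∀ t ∈ Ioo s (s + 1), t ∉ D → ∀ i, x' i t ≤ ∑ j, B t i j * (x j t - x i t) + G)
    {r : ι} {p : ι → ι} {φ q : ℝ → ℝ} (hφ : ContinuousOn φ (Icc s (s + 1))) (hφa : φ s = 0)
    (hφ0 : ∀ t ∈ Icc s (s + 1), 0 ≤ φ t) (hφ1 : ∀ t ∈ Icc s (s + 1), φ t ≤ 1)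
    (hφd : ∀ t ∈ Ioo s (s + 1), t ∉ D → HasDerivAt φ (q t) t)
    (hq0 : ∀ t ∈ Ioo s (s + 1), 0 ≤ q t)
    (hq : ∀ t ∈ Ioo s (s + 1), ∀ i, i ≠ r → q t ≤ B t i (p i))
    (hv₀ : 0 ≤ v₀) (hhi : ∀ i, x i s ≤ hi) (hr : x r s ≤ hi - v₀) {m : ℕ} {i : ι}
    (hm : p^[m] i = r) :
    x i (s + 1) ≤ hi + G - Real.exp (-β) * (v₀ * (φ (s + 1) ^ m / m.factorial)) := by
  have hyc : ∀ i, ContinuousOn (fun t => x i t + G * (s + 1 - t)) (Icc s (s + 1)) := fun i =>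
    (hx i).add (Continuous.continuousOn (by fun_prop))
  have hyd : ∀ t ∈ Ioo s (s + 1), t ∉ D → ∀ i,
      HasDerivAt (fun t => x i t + G * (s + 1 - t)) (x' i t - G) t := by
    intro t ht htD i
    have h1 : HasDerivAt (fun t => G * (s + 1 - t)) (-G) t := by
      simpa using ((hasDerivAt_id t).const_sub (s + 1)).const_mul G
    rw [sub_eq_add_neg (x' i t)]
    exact (hd t ht htD i).add h1
  have hyle : ∀ t ∈ Ioo s (s + 1), t ∉ D → ∀ i, x' i t - G ≤
      ∑ j, B t i j * ((x j t + G * (s + 1 - t)) - (x i t + G * (s + 1 - t))) := by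
    intro t ht htD i
    simp only [add_sub_add_right_eq_sub]
    linarith [hle t ht htD i]
  have hpos : ∀ t ∈ Icc s (s + 1), ∀ i, 0 ≤ hi + G - (x i t + G * (s + 1 - t)) := by
    intro t ht i
    have hsub : Ioo s t ⊆ Ioo s (s + 1) := Ioo_subset_Ioo_right ht.2
    have := le_add_of_perturbed_subsolution ht.1
      (fun i => (hx i).mono (Icc_subset_Icc_right ht.2)) hD
      (fun z hz => hd z (hsub hz)) (fun z hz => hB z (hsub hz))
      (fun z hz => hle z (hsub hz)) hhi i
    linarith
  have key := lift_along_tree (u := fun i t => hi + G - (x i t + G * (s + 1 - t)))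
    (u' := fun i t => -(x' i t - G)) (fun i => continuousOn_const.sub (hyc i)) hD
    (fun t ht htD i => (hyd t ht htD i).const_sub _) hB hβ
    (fun t ht htD i => by
      have := hyle t ht htD i
      have h2 : ∑ j, B t i j * ((hi + G - (x j t + G * (s + 1 - t))) -
          (hi + G - (x i t + G * (s + 1 - t)))) =
          -∑ j, B t i j * ((x j t + G * (s + 1 - t)) - (x i t + G * (s + 1 - t))) := by
        rw [← Finset.sum_neg_distrib]
        exact Finset.sum_congr rfl fun j _ => by ring
      rw [h2]
      linarith) hpos hφ hφa hφ0 hφ1 hφd hq0 hq hv₀ (by linarith) m i hm (s + 1)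
    (right_mem_Icc.2 (by linarith))
  simp only [add_sub_cancel_left, mul_one, sub_self, mul_zero, add_zero] at key
  have := mul_le_mul_of_nonneg_left key (Real.exp_pos (-β)).le
  rw [← mul_assoc (Real.exp (-β)) (Real.exp β), ← Real.exp_add, neg_add_cancel, Real.exp_zero,
    one_mul] at this
  linarith

/-! ### A tree that carries weight over a window -/

/-- The pairs of a root and a parent map which describe a directed spanning tree on the vertex set
`ι`: following parents leads from every vertex to the root. The parent of the root is arbitrary. -/
abbrev SpanningRootedTree (ι : Type*) : Type _ :=
  {T : ι × (ι → ι) // ∀ i, ∃ m : ℕ, T.2^[m] i = T.1}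

/-- The product of the weights along the edges of a tree, each truncated at `1`. For nonnegative
weights it is a minorant of all of them with values in `[0, 1]`, and it is continuous wherever they
are. (The indicator function of the times at which the tree is present need not be piecewise
continuous.) -/
def treeWeight {ι : Type*} [Fintype ι] [DecidableEq ι] (B : ℝ → ι → ι → ℝ)
    (T : SpanningRootedTree ι) (t : ℝ) : ℝ :=
  ∏ i, if i = T.1.1 then 1 else min 1 (B t i (T.1.2 i))

section
variable {ι : Type*} [DecidableEq ι] {B : ℝ → ι → ι → ℝ} {T : SpanningRootedTree ι} {t : ℝ}

theorem treeWeight_factor_mem (h : ∀ i j, 0 ≤ B t i j) (i : ι) :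
    (if i = T.1.1 then 1 else min 1 (B t i (T.1.2 i))) ∈ Icc (0 : ℝ) 1 := by
  split_ifs
  · exact ⟨zero_le_one, le_rfl⟩
  · exact ⟨le_min zero_le_one (h _ _), min_le_left _ _⟩

variable [Fintype ι]

theorem treeWeight_nonneg (h : ∀ i j, 0 ≤ B t i j) : 0 ≤ treeWeight B T t :=
  Finset.prod_nonneg fun i _ => (treeWeight_factor_mem h i).1

theorem treeWeight_le_one (h : ∀ i j, 0 ≤ B t i j) : treeWeight B T t ≤ 1 :=
  Finset.prod_le_one (fun i _ => (treeWeight_factor_mem h i).1)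
    fun i _ => (treeWeight_factor_mem h i).2

theorem treeWeight_le (h : ∀ i j, 0 ≤ B t i j) {i : ι} (hi : i ≠ T.1.1) :
    treeWeight B T t ≤ B t i (T.1.2 i) := by
  rw [treeWeight, ← Finset.mul_prod_erase _ _ (Finset.mem_univ i), if_neg hi]
  exact (mul_le_of_le_one_right (le_min zero_le_one (h _ _))
    (Finset.prod_le_one (fun k _ => (treeWeight_factor_mem h k).1)
      fun k _ => (treeWeight_factor_mem h k).2)).trans (min_le_right _ _)

theorem pow_le_treeWeight {κ : ℝ} (hκ : 0 < κ) (h : ∀ i, i ≠ T.1.1 → κ ≤ B t i (T.1.2 i)) :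
    min 1 κ ^ Fintype.card ι ≤ treeWeight B T t := by
  have h0 : 0 ≤ min 1 κ := le_min zero_le_one hκ.le
  calc min 1 κ ^ Fintype.card ι = ∏ _i : ι, min 1 κ := by simp
    _ ≤ _ := Finset.prod_le_prod (fun _ _ => h0) fun i _ => by
      split_ifs with hi
      · exact min_le_left _ _
      · exact min_le_min_left _ (h i hi)

theorem continuousAt_treeWeight (h : ∀ i j, ContinuousAt (fun t => B t i j) t) :
    ContinuousAt (treeWeight B T) t := by
  refine tendsto_finsetProd _ fun i _ => ?_
  split_ifs
  · exact tendsto_const_nhds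
  · exact (continuousAt_const.min (h _ _) :)

end

open MeasureTheory in
theorem exists_primitive_off_countable {q : ℝ → ℝ} {a b : ℝ} {D : Set ℝ} (hD : D.Countable)
    (hqc : ∀ t ∈ Ioo a b, t ∉ D → ContinuousAt q t)
    (hq : ∀ t ∈ Ioo a b, |q t| ≤ 1) (hab : a ≤ b) :
    ∃ φ : ℝ → ℝ, ContinuousOn φ (Icc a b) ∧ φ a = 0 ∧
      ∀ t ∈ Ioo a b, t ∉ D → HasDerivAt φ (q t) t := by
  have hms : AEStronglyMeasurable q (volume.restrict (Ioo a b)) := by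
    have h1 : ContinuousOn q (Ioo a b \ D) := fun t ht => (hqc t ht.1 ht.2).continuousWithinAt
    have h2 := h1.aestronglyMeasurable (μ := volume) (measurableSet_Ioo.diff hD.measurableSet)
    rwa [Measure.restrict_congr_set (sdiff_null_ae_eq_self (hD.measure_zero volume))] at h2
  have hint : IntegrableOn q (Ioo a b) :=
    IntegrableOn.of_bound (by simp) hms 1
      ((ae_restrict_iff' measurableSet_Ioo).2 (ae_of_all _ hq))
  have hII : IntervalIntegrable q volume a b := by
    rw [intervalIntegrable_iff_integrableOn_Ioo_of_le hab]
    exact hint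
  refine ⟨fun t => ∫ z in a..t, q z, ?_, intervalIntegral.integral_same, fun t ht htD => ?_⟩
  · have := intervalIntegral.continuousOn_primitive_interval
      (f := q) (μ := volume) (a := a) (b := b) (by
        rw [uIcc_of_le hab, integrableOn_Icc_iff_integrableOn_Ioo]; exact hint)
    rwa [uIcc_of_le hab] at this
  · exact intervalIntegral.integral_hasDerivAt_right
      (hII.mono_set (by
        rw [uIcc_of_le hab, uIcc_of_le ht.1.le]; exact Icc_subset_Icc_right ht.2.le))
      ⟨Ioo a b, Ioo_mem_nhds ht.1 ht.2, hms⟩ (hqc t ht htD)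

/-- Although the tree may change with time, some fixed tree is present, in the integrated sense,
with a weight bounded below: at each time the tree that is present has `treeWeight` at least
`min 1 κ ^ card ι`, so that the integrals of the weights of all trees add up to at least that. -/
theorem exists_tree_of_window {ι : Type*} [Fintype ι] [DecidableEq ι] {B : ℝ → ι → ι → ℝ}
    {s κ : ℝ} (hκ : 0 < κ) {D : Set ℝ} (hD : D.Countable)
    (hBc : ∀ t ∈ Ioo s (s + 1), t ∉ D → ∀ i j, ContinuousAt (fun t => B t i j) t)
    (hB : ∀ t ∈ Ioo s (s + 1), ∀ i j, 0 ≤ B t i j)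
    (htree : ∀ t ∈ Ioo s (s + 1),
      ∃ T : SpanningRootedTree ι, ∀ i, i ≠ T.1.1 → κ ≤ B t i (T.1.2 i)) :
    ∃ (T : SpanningRootedTree ι) (φ : ℝ → ℝ), ContinuousOn φ (Icc s (s + 1)) ∧ φ s = 0 ∧
      (∀ t ∈ Icc s (s + 1), 0 ≤ φ t) ∧ (∀ t ∈ Icc s (s + 1), φ t ≤ 1) ∧
      (∀ t ∈ Ioo s (s + 1), t ∉ D → HasDerivAt φ (treeWeight B T t) t) ∧
      min 1 κ ^ Fintype.card ι / Nat.card (SpanningRootedTree ι) ≤ φ (s + 1) := by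
  classical
  have hs : s ≤ s + 1 := by linarith
  choose φ hφc hφs hφd using fun T : SpanningRootedTree ι =>
    exists_primitive_off_countable (q := treeWeight B T) hD
      (fun t ht htD => continuousAt_treeWeight (hBc t ht htD))
      (fun t ht => by
        rw [abs_of_nonneg (treeWeight_nonneg (hB t ht))]
        exact treeWeight_le_one (hB t ht)) hs
  obtain ⟨T₀, -⟩ := htree (s + 1 / 2) ⟨by linarith, by linarith⟩
  obtain ⟨T, -, hT⟩ : ∃ T ∈ (Finset.univ : Finset (SpanningRootedTree ι)),
      min 1 κ ^ Fintype.card ι / Nat.card (SpanningRootedTree ι) ≤ φ T (s + 1) := by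
    refine Finset.exists_le_of_sum_le ⟨T₀, Finset.mem_univ _⟩ ?_
    have hcard : (Nat.card (SpanningRootedTree ι) : ℝ) ≠ 0 := by
      have : Nonempty (SpanningRootedTree ι) := ⟨T₀⟩
      exact_mod_cast Nat.card_pos.ne'
    rw [Finset.sum_const, nsmul_eq_mul, Finset.card_univ, ← Nat.card_eq_fintype_card,
      mul_div_cancel₀ _ hcard]
    have := le_of_hasDerivAt_nonneg_off_countable
      (f := fun t => ∑ T, φ T t - min 1 κ ^ Fintype.card ι * t) hs
      ((continuousOn_finsetSum _ fun T _ => hφc T).sub (Continuous.continuousOn (by fun_prop))) hD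
      (fun t ht htD => (HasDerivAt.fun_sum fun T _ => hφd T t ht htD).sub
        ((hasDerivAt_id t).const_mul (min 1 κ ^ Fintype.card ι)))
      (fun t ht htD => by
        obtain ⟨T, hT⟩ := htree t ht
        have h1 := pow_le_treeWeight hκ hT
        have h2 : treeWeight B T t ≤ ∑ T, treeWeight B T t :=
          Finset.single_le_sum (f := fun T => treeWeight B T t)
            (fun T _ => treeWeight_nonneg (hB t ht)) (Finset.mem_univ T)
        linarith)
    simp only [hφs, Finset.sum_const_zero] at this
    linarith
  refine ⟨T, φ T, hφc T, hφs T, fun t ht => ?_, fun t ht => ?_, hφd T, hT⟩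
  · have hsub : Ioo s t ⊆ Ioo s (s + 1) := Ioo_subset_Ioo_right ht.2
    have := le_of_hasDerivAt_nonneg_off_countable ht.1
      ((hφc T).mono (Icc_subset_Icc_right ht.2)) hD
      (fun z hz hzD => hφd T z (hsub hz) hzD) (fun z hz _ => treeWeight_nonneg (hB z (hsub hz)))
    rwa [hφs T] at this
  · have hsub : Ioo s t ⊆ Ioo s (s + 1) := Ioo_subset_Ioo_right ht.2
    have := abs_sub_le_of_hasDerivAt_off_countable (C := 1) ht.1
      ((hφc T).mono (Icc_subset_Icc_right ht.2)) hD
      (fun z hz hzD => hφd T z (hsub hz) hzD) (fun z hz _ => by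
        rw [abs_of_nonneg (treeWeight_nonneg (hB z (hsub hz)))]
        exact treeWeight_le_one (hB z (hsub hz)))
    rw [hφs T] at this
    linarith [(abs_le.1 this).2, ht.2]

/-! ### Contraction and decay of the spread -/

/-- The spread of perturbed consensus dynamics contracts on every window of length one, by a
factor depending only on the bounds on the weights. -/
theorem exists_spread_contraction (ι : Type*) [Fintype ι] {β κ : ℝ} (hκ : 0 < κ) :
    ∃ c : ℝ, 0 < c ∧ ∀ (D : Set ℝ) (s G d : ℝ) (B : ℝ → ι → ι → ℝ) (x x' : ι → ℝ → ℝ),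
      D.Countable → (∀ i, ContinuousOn (x i) (Icc s (s + 1))) →
      (∀ t ∈ Ioo s (s + 1), t ∉ D → ∀ i, HasDerivAt (x i) (x' i t) t) →
      (∀ t ∈ Ioo s (s + 1), t ∉ D → ∀ i j, ContinuousAt (fun t => B t i j) t) →
      (∀ t ∈ Ioo s (s + 1), ∀ i j, 0 ≤ B t i j) →
      (∀ t ∈ Ioo s (s + 1), ∀ i, ∑ j, B t i j ≤ β) →
      (∀ t ∈ Ioo s (s + 1), ∃ T : SpanningRootedTree ι, ∀ i, i ≠ T.1.1 → κ ≤ B t i (T.1.2 i)) →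
      (∀ t ∈ Ioo s (s + 1), t ∉ D → ∀ i, |x' i t - ∑ j, B t i j * (x j t - x i t)| ≤ G) →
      (∀ i j, x i s - x j s ≤ d) →
      ∀ i j, x i (s + 1) - x j (s + 1) ≤ (1 - c) * d + 2 * G := by
  classical
  rcases isEmpty_or_nonempty ι with hι | hι
  · exact ⟨1, one_pos, by intros; exact isEmptyElim ‹ι›⟩
  choose depth hdepth using fun (T : SpanningRootedTree ι) (i : ι) => T.2 i
  obtain ⟨L, hL⟩ : ∃ L, ∀ T i, depth T i ≤ L := by
    refine ⟨Finset.univ.sup fun Ti : SpanningRootedTree ι × ι => depth Ti.1 Ti.2, fun T i => ?_⟩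
    exact Finset.le_sup (f := fun Ti : SpanningRootedTree ι × ι => depth Ti.1 Ti.2)
      (Finset.mem_univ (T, i))
  set δ : ℝ := min 1 κ ^ Fintype.card ι / Nat.card (SpanningRootedTree ι) with hδ
  have hδ0 : 0 < δ := by
    have : Nonempty (SpanningRootedTree ι) := ⟨⟨(hι.some, fun _ => hι.some), fun _ => ⟨1, rfl⟩⟩⟩
    have h1 : (0 : ℝ) < Nat.card (SpanningRootedTree ι) := by exact_mod_cast Nat.card_pos
    have h2 : 0 < min 1 κ := lt_min one_pos hκ
    positivity
  set c : ℝ := Real.exp (-β) * (δ ^ L / L.factorial) with hc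
  have hc0 : 0 < c := by positivity
  refine ⟨min 1 (c / 2), lt_min one_pos (by positivity), ?_⟩
  intro D s G d B x x' hD hx hd hBc hB hβ htree hle hspread i j
  obtain ⟨T, φ, hφc, hφs, hφ0, hφ1, hφd, hφδ⟩ := exists_tree_of_window hκ hD hBc hB htree
  have hlift : ∀ i, δ ^ L / L.factorial ≤
      φ (s + 1) ^ depth T i / (depth T i).factorial := by
    intro i
    have h1 : φ (s + 1) ≤ 1 := hφ1 _ (right_mem_Icc.2 (by linarith))
    have h0 : 0 < φ (s + 1) := hδ0.trans_le hφδ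
    have h3 : ((depth T i).factorial : ℝ) ≤ L.factorial := by
      exact_mod_cast Nat.factorial_le (hL T i)
    have h4 : δ ^ L ≤ φ (s + 1) ^ depth T i :=
      (pow_le_pow_left₀ hδ0.le hφδ L).trans (pow_le_pow_of_le_one h0.le h1 (hL T i))
    exact div_le_div₀ (by positivity) h4 (by positivity) h3
  obtain ⟨iM, hiM⟩ := Finite.exists_max fun i => x i s
  obtain ⟨im, him⟩ := Finite.exists_min fun i => x i s
  set v₀ := (x iM s - x im s) / 2 with hv
  have hv0 : 0 ≤ v₀ := by have := hiM im; simp only [hv]; linarith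
  have hstep : ∀ i, c * v₀ ≤
      Real.exp (-β) * (v₀ * (φ (s + 1) ^ depth T i / (depth T i).factorial)) := by
    intro i
    have := mul_le_mul_of_nonneg_left (mul_le_mul_of_nonneg_left (hlift i) hv0)
      (Real.exp_pos (-β)).le
    calc c * v₀ = Real.exp (-β) * (v₀ * (δ ^ L / L.factorial)) := by rw [hc]; ring
      _ ≤ _ := this
  have hup : ∀ v, 0 ≤ v → x T.1.1 s ≤ x iM s - v → ∀ i, x i (s + 1) ≤ x iM s + G -
      Real.exp (-β) * (v * (φ (s + 1) ^ depth T i / (depth T i).factorial)) := by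
    intro v hv hr i
    exact upper_bound_of_tree hx hD hd hB hβ
      (fun t ht htD i => by linarith [(abs_le.1 (hle t ht htD i)).2]) hφc hφs hφ0 hφ1 hφd
      (fun t ht => treeWeight_nonneg (hB t ht)) (fun t ht i hi => treeWeight_le (hB t ht) hi)
      hv hiM hr (hdepth T i)
  have hlo : ∀ v, 0 ≤ v → - x T.1.1 s ≤ - x im s - v → ∀ i, - x i (s + 1) ≤ - x im s + G -
      Real.exp (-β) * (v * (φ (s + 1) ^ depth T i / (depth T i).factorial)) := by
    intro v hv hr i
    exact upper_bound_of_tree (x := fun i t => - x i t) (x' := fun i t => - x' i t)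
      (fun i => (hx i).neg) hD (fun t ht htD i => (hd t ht htD i).neg) hB hβ
      (fun t ht htD i => by
        have h2 : ∑ j, B t i j * (-x j t - -x i t) = -∑ j, B t i j * (x j t - x i t) := by
          rw [← Finset.sum_neg_distrib]
          exact Finset.sum_congr rfl fun j _ => by ring
        rw [h2]
        linarith [(abs_le.1 (hle t ht htD i)).1]) hφc hφs hφ0 hφ1 hφd
      (fun t ht => treeWeight_nonneg (hB t ht)) (fun t ht i hi => treeWeight_le (hB t ht) hi)
      hv (fun i => neg_le_neg (him i)) hr (hdepth T i)
  have hd' : 2 * v₀ ≤ d := by have := hspread iM im; simp only [hv]; linarith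
  have hfin : x i (s + 1) - x j (s + 1) ≤ 2 * v₀ + 2 * G - c * v₀ := by
    -- the root starts in the lower or in the upper half of the range
    rcases le_total (x T.1.1 s) (x iM s - v₀) with hr | hr
    · have h1 := hup v₀ hv0 hr i
      have h2 := hlo 0 le_rfl (by linarith [him T.1.1]) j
      rw [zero_mul, mul_zero] at h2
      linarith [hstep i]
    · have h1 := hup 0 le_rfl (by linarith [hiM T.1.1]) i
      have h2 := hlo v₀ hv0 (by linarith) j
      rw [zero_mul, mul_zero] at h1
      linarith [hstep j]
  have h1 : min 1 (c / 2) * (2 * v₀) ≤ c / 2 * (2 * v₀) :=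
    mul_le_mul_of_nonneg_right (min_le_right _ _) (by linarith)
  have h2 : (1 - min 1 (c / 2)) * (2 * v₀) ≤ (1 - min 1 (c / 2)) * d :=
    mul_le_mul_of_nonneg_left hd' (sub_nonneg.2 (min_le_left _ _))
  linarith

/-- Perturbed consensus dynamics on `[t₀, T)`: the spread decays as fast as the perturbation, if the
latter is dominated by a function `θ` that decays more slowly than exponentially. -/
theorem exists_spread_le_mul {ι : Type*} [Fintype ι] {β κ K₀ t₀ : ℝ} {T : EReal} {θ : ℝ → ℝ}
    (hκ : 0 < κ) (hK₀ : 0 ≤ K₀) (hθ₀ : ∀ t, t₀ ≤ t → 0 < θ t) (hθa : AntitoneOn θ (Ici t₀))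
    (hθ : ∀ ε > 0, ∃ s₁, t₀ ≤ s₁ ∧ ∀ s, s₁ ≤ s → (1 - ε) * θ s ≤ θ (s + 1))
    {D : Set ℝ} {B : ℝ → ι → ι → ℝ} {x x' : ι → ℝ → ℝ} (hD : D.Countable)
    (hx : ∀ i, ContinuousOn (x i) (Ici t₀))
    (hd : ∀ t, t₀ < t → (t : EReal) < T → t ∉ D → ∀ i, HasDerivAt (x i) (x' i t) t)
    (hBc : ∀ t, t₀ < t → t ∉ D → ∀ i j, ContinuousAt (fun t => B t i j) t)
    (hB : ∀ t, t₀ ≤ t → ∀ i j, 0 ≤ B t i j) (hβ : ∀ t, t₀ ≤ t → ∀ i, ∑ j, B t i j ≤ β)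
    (htree : ∀ t, t₀ ≤ t → ∃ T : SpanningRootedTree ι, ∀ i, i ≠ T.1.1 → κ ≤ B t i (T.1.2 i))
    (hle : ∀ t, t₀ < t → (t : EReal) < T → t ∉ D → ∀ i,
      |x' i t - ∑ j, B t i j * (x j t - x i t)| ≤ K₀ * θ t) :
    ∃ K, 0 ≤ K ∧ ∀ t, t₀ ≤ t → (t : EReal) < T → ∀ i j, x i t - x j t ≤ K * θ t := by
  obtain ⟨c, hc, hcontr⟩ := exists_spread_contraction ι (β := β) hκ
  obtain ⟨s₁, hs₁, hslow⟩ := hθ (c / 2) (by positivity)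
  have hθs : 0 < θ (s₁ + 1) := hθ₀ _ (by linarith)
  set H : ℝ := ∑ i, |x i t₀| with hH
  have hH0 : 0 ≤ H := Finset.sum_nonneg fun i _ => abs_nonneg _
  have hxH : ∀ i, |x i t₀| ≤ H := fun i =>
    Finset.single_le_sum (f := fun i => |x i t₀|) (fun i _ => abs_nonneg _) (Finset.mem_univ i)
  set H' : ℝ := 2 * H + 2 * (K₀ * θ t₀) * (s₁ + 1 - t₀) with hH'
  have hKθ : 0 ≤ K₀ * θ t₀ := mul_nonneg hK₀ (hθ₀ _ le_rfl).le
  have hH'0 : 0 ≤ H' := by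
    have : 0 ≤ s₁ + 1 - t₀ := by linarith
    positivity
  have hcrude : ∀ t, t₀ ≤ t → t ≤ s₁ + 1 → (t : EReal) < T → ∀ i j, x i t - x j t ≤ H' := by
    intro t ht hts htT i j
    have hlt : ∀ z ∈ Ioo t₀ t, (z : EReal) < T := fun z hz =>
      (EReal.coe_lt_coe hz.2).trans htT
    have hle' : ∀ z ∈ Ioo t₀ t, z ∉ D → ∀ i,
        |x' i z - ∑ j, B z i j * (x j z - x i z)| ≤ K₀ * θ t₀ := fun z hz hzD i =>
      (hle z hz.1 (hlt z hz) hzD i).trans (mul_le_mul_of_nonneg_left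
        (hθa self_mem_Ici (mem_Ici.2 hz.1.le) hz.1.le) hK₀)
    have h1 := le_add_of_perturbed_subsolution (G := K₀ * θ t₀) (hi := H) ht
      (fun i => (hx i).mono Icc_subset_Ici_self) hD
      (fun z hz hzD => hd z hz.1 (hlt z hz) hzD) (fun z hz => hB z hz.1.le)
      (fun z hz hzD i => by linarith [(abs_le.1 (hle' z hz hzD i)).2])
      (fun i => (le_abs_self _).trans (hxH i)) i
    have h2 := le_add_of_perturbed_subsolution (x := fun i t => - x i t) (G := K₀ * θ t₀)
      (hi := H) ht (fun i => ((hx i).mono Icc_subset_Ici_self).neg) hD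
      (fun z hz hzD i => (hd z hz.1 (hlt z hz) hzD i).neg) (fun z hz => hB z hz.1.le)
      (fun z hz hzD i => by
        have h2 : ∑ j, B z i j * (-x j z - -x i z) = -∑ j, B z i j * (x j z - x i z) := by
          rw [← Finset.sum_neg_distrib]
          exact Finset.sum_congr rfl fun j _ => by ring
        rw [h2]
        linarith [(abs_le.1 (hle' z hz hzD i)).1])
      (fun i => (neg_le_abs _).trans (hxH i)) j
    have h3 : K₀ * θ t₀ * (t - t₀) ≤ K₀ * θ t₀ * (s₁ + 1 - t₀) :=
      mul_le_mul_of_nonneg_left (by linarith) hKθ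
    linarith
  -- the second summand makes the contraction absorb the perturbation on each window
  set K : ℝ := H' / θ (s₁ + 1) + 4 * K₀ / c with hK
  have hK0 : 0 ≤ K := by positivity
  have hKc : 2 * K₀ ≤ c / 2 * K := by
    have h1 : c / 2 * (4 * K₀ / c) = 2 * K₀ := by field_simp; ring
    have h2 : 0 ≤ c / 2 * (H' / θ (s₁ + 1)) := by positivity
    rw [hK, mul_add]
    linarith
  refine ⟨K, hK0, ?_⟩
  have hind : ∀ m : ℕ, ∀ t, t₀ ≤ t → t ≤ s₁ + 1 + m → (t : EReal) < T →
      ∀ i j, x i t - x j t ≤ K * θ t := by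
    intro m
    induction m with
    | zero =>
      intro t ht hts htT i j
      have hts' : t ≤ s₁ + 1 := by simpa using hts
      refine (hcrude t ht hts' htT i j).trans ?_
      calc H' = H' / θ (s₁ + 1) * θ (s₁ + 1) := (div_mul_cancel₀ _ hθs.ne').symm
        _ ≤ K * θ (s₁ + 1) := mul_le_mul_of_nonneg_right
            (le_add_of_nonneg_right (by positivity)) hθs.le
        _ ≤ K * θ t := mul_le_mul_of_nonneg_left
            (hθa (mem_Ici.2 ht) (mem_Ici.2 (by linarith)) hts') hK0
    | succ m ih =>
      intro t ht hts htT i j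
      rcases le_total t (s₁ + 1 + m) with htm | htm
      · exact ih t ht htm htT i j
      push_cast at hts
      obtain ⟨s, rfl⟩ : ∃ s, t = s + 1 := ⟨t - 1, by ring⟩
      have hss : s₁ ≤ s := by have : (0 : ℝ) ≤ m := m.cast_nonneg; linarith
      have hst : t₀ ≤ s := hs₁.trans hss
      have hlt : ∀ z ∈ Ioo s (s + 1), (z : EReal) < T := fun z hz =>
        (EReal.coe_lt_coe hz.2).trans htT
      have hgt : ∀ z ∈ Ioo s (s + 1), t₀ < z := fun z hz => hst.trans_lt hz.1
      have h1 := hcontr D s (K₀ * θ s) (K * θ s) B x x' hD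
        (fun i => (hx i).mono fun z hz => hst.trans hz.1)
        (fun z hz hzD => hd z (hgt z hz) (hlt z hz) hzD)
        (fun z hz hzD => hBc z (hgt z hz) hzD) (fun z hz => hB z (hgt z hz).le)
        (fun z hz => hβ z (hgt z hz).le) (fun z hz => htree z (hgt z hz).le)
        (fun z hz hzD i => (hle z (hgt z hz) (hlt z hz) hzD i).trans
          (mul_le_mul_of_nonneg_left
            (hθa (mem_Ici.2 hst) (mem_Ici.2 (hgt z hz).le) hz.1.le) hK₀))
        (ih s hst (by linarith) ((EReal.coe_lt_coe (by linarith)).trans htT)) i j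
      have h2 := mul_le_mul_of_nonneg_left (hslow s hss) hK0
      have h3 := mul_le_mul_of_nonneg_right hKc (hθ₀ s hst).le
      linarith
  intro t ht htT
  obtain ⟨m, hm⟩ := exists_nat_ge (t - (s₁ + 1))
  exact hind m t ht (by linarith) htT

/-! ### The flow of `S` -/

section
variable {n : ℕ} (S : Matrix (Fin n) (Fin n) ℝ)

/-- The endomorphism of Euclidean space given by `S`, the generator of `expFlow S`. -/
def flowGenerator : EuclideanSpace ℝ (Fin n) →L[ℝ] EuclideanSpace ℝ (Fin n) :=
  Matrix.toEuclideanCLM (n := Fin n) (𝕜 := ℝ) S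

theorem flowGenerator_apply (v : EuclideanSpace ℝ (Fin n)) (l : Fin n) :
    flowGenerator S v l = ∑ k, S l k * v k := rfl

theorem expFlow_zero : expFlow S 0 = 1 :=
  (congrArg NormedSpace.exp (zero_smul ℝ (flowGenerator S))).trans NormedSpace.exp_zero

theorem expFlow_add (s t : ℝ) : expFlow S (s + t) = expFlow S s * expFlow S t := by
  let : NormedAlgebra ℚ (EuclideanSpace ℝ (Fin n) →L[ℝ] EuclideanSpace ℝ (Fin n)) :=
    .restrictScalars ℚ ℝ _
  have hcomm : Commute (s • flowGenerator S) (t • flowGenerator S) :=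
    ContinuousLinearMap.ext fun v => by
      simp only [mul_apply_eq_comp, smul_apply, map_smul]
      exact smul_comm t s (flowGenerator S (flowGenerator S v))
  exact (congrArg NormedSpace.exp (add_smul s t (flowGenerator S))).trans
    (NormedSpace.exp_add_of_commute hcomm)

theorem expFlow_add_apply (s t : ℝ) (v : EuclideanSpace ℝ (Fin n)) :
    expFlow S (s + t) v = expFlow S s (expFlow S t v) := by
  rw [expFlow_add]; rfl

theorem hasDerivAt_expFlow (t : ℝ) :
    HasDerivAt (expFlow S)
      (expFlow S t * flowGenerator S) t :=
  hasDerivAt_exp_smul_const (flowGenerator S) t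

theorem continuous_expFlow : Continuous (expFlow S) :=
  continuous_iff_continuousAt.2 fun t => (hasDerivAt_expFlow S t).continuousAt

/-- On the real and imaginary parts of an eigenvector for `iω`, the flow is a rotation. -/
theorem expFlow_rotation {a b : EuclideanSpace ℝ (Fin n)} {ω : ℝ}
    (ha : flowGenerator S a = -ω • b)
    (hb : flowGenerator S b = ω • a) (t : ℝ) :
    expFlow S t (Real.cos (ω * t) • a + Real.sin (ω * t) • b) = a := by
  have hlin (t : ℝ) : HasDerivAt (fun t => ω * t) ω t := by
    simpa using (hasDerivAt_id t).const_mul ω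
  -- the derivative of the left-hand side vanishes
  have hd : ∀ t, HasDerivAt
      (fun t => expFlow S t (Real.cos (ω * t) • a + Real.sin (ω * t) • b)) 0 t := by
    intro t
    have h1 := (hasDerivAt_expFlow S t).clm_apply
      (((hlin t).cos.smul_const a).add ((hlin t).sin.smul_const b))
    refine h1.congr_deriv ?_
    rw [mul_apply_eq_comp, Pi.add_apply, ← map_add, map_add (flowGenerator S), map_smul, map_smul,
      ha, hb, ← map_zero (expFlow S t)]
    congr 1
    module
  have := is_const_of_deriv_eq_zero (fun t => (hd t).differentiableAt) (fun t => (hd t).deriv) t 0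
  simpa [expFlow_zero] using this

theorem norm_expFlow_le_of_rotation {a b : EuclideanSpace ℝ (Fin n)} {ω : ℝ}
    (ha : flowGenerator S a = -ω • b)
    (hb : flowGenerator S b = ω • a) (t : ℝ) :
    ‖expFlow S t a‖ ≤ ‖a‖ + ‖b‖ := by
  have h := congrArg (expFlow S t) (expFlow_rotation S ha hb (-t))
  rw [← expFlow_add_apply, add_neg_cancel, expFlow_zero] at h
  rw [← h]
  refine (norm_add_le _ _).trans (add_le_add ?_ ?_)
  · rw [norm_smul]
    exact mul_le_of_le_one_left (norm_nonneg _) (Real.abs_cos_le_one _)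
  · rw [norm_smul]
    exact mul_le_of_le_one_left (norm_nonneg _) (Real.abs_sin_le_one _)

/-- The complex vectors whose real and imaginary parts have bounded orbits under the flow. -/
def boundedOrbits : Submodule ℂ (Fin n → ℂ) where
  carrier := {v | ∃ C, ∀ t, ‖expFlow S t (WithLp.toLp 2 fun l => (v l).re)‖ ≤ C ∧
    ‖expFlow S t (WithLp.toLp 2 fun l => (v l).im)‖ ≤ C}
  zero_mem' := ⟨0, fun t => by
    have : (WithLp.toLp 2 fun _ : Fin n => (0 : ℝ)) = 0 := rfl
    simp [this]⟩
  add_mem' := by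
    rintro v w ⟨C, hC⟩ ⟨C', hC'⟩
    refine ⟨C + C', fun t => ⟨?_, ?_⟩⟩
    · have : (WithLp.toLp 2 fun l => ((v + w) l).re) =
        (WithLp.toLp 2 fun l => (v l).re) + WithLp.toLp 2 fun l => (w l).re := rfl
      rw [this, map_add]
      exact (norm_add_le _ _).trans (add_le_add (hC t).1 (hC' t).1)
    · have : (WithLp.toLp 2 fun l => ((v + w) l).im) =
        (WithLp.toLp 2 fun l => (v l).im) + WithLp.toLp 2 fun l => (w l).im := rfl
      rw [this, map_add]
      exact (norm_add_le _ _).trans (add_le_add (hC t).2 (hC' t).2)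
  smul_mem' := by
    rintro z v ⟨C, hC⟩
    refine ⟨|z.re| * C + |z.im| * C, fun t => ⟨?_, ?_⟩⟩
    · have : (WithLp.toLp 2 fun l => ((z • v) l).re) =
        z.re • (WithLp.toLp 2 fun l => (v l).re) - z.im • WithLp.toLp 2 fun l => (v l).im := by
        ext l; simp
      rw [this, map_sub, map_smul, map_smul]
      refine (norm_sub_le _ _).trans (add_le_add ?_ ?_) <;> rw [norm_smul, Real.norm_eq_abs]
      · exact mul_le_mul_of_nonneg_left (hC t).1 (abs_nonneg _)
      · exact mul_le_mul_of_nonneg_left (hC t).2 (abs_nonneg _)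
    · have : (WithLp.toLp 2 fun l => ((z • v) l).im) =
        z.re • (WithLp.toLp 2 fun l => (v l).im) + z.im • WithLp.toLp 2 fun l => (v l).re := by
        ext l; simp
      rw [this, map_add, map_smul, map_smul]
      refine (norm_add_le _ _).trans (add_le_add ?_ ?_) <;> rw [norm_smul, Real.norm_eq_abs]
      · exact mul_le_mul_of_nonneg_left (hC t).2 (abs_nonneg _)
      · exact mul_le_mul_of_nonneg_left (hC t).1 (abs_nonneg _)

variable {S}

/-- By semisimplicity the eigenvectors span, and their eigenvalues are imaginary, so that their
orbits are bounded. -/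
theorem boundedOrbits_eq_top (hS : IsSemisimpleWithImaginarySpectrum S) :
    boundedOrbits S = ⊤ := by
  rw [eq_top_iff, ← hS.1.iSup_eigenspace_eq_top]
  refine iSup_le fun z v hv => ?_
  rcases eq_or_ne v 0 with rfl | hv0
  · exact zero_mem _
  have hz : z.re = 0 := hS.2 z (by
    rw [← Matrix.spectrum_toLin']
    exact (Module.End.hasEigenvalue_of_hasEigenvector ⟨hv, hv0⟩).mem_spectrum)
  have hv' := Module.End.mem_eigenspace_iff.1 hv
  have hre : flowGenerator S (WithLp.toLp 2 fun l => (v l).re) =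
      -z.im • WithLp.toLp 2 fun l => (v l).im := by
    ext l
    have := congrArg Complex.re (congrFun hv' l)
    simpa [Matrix.mulVec, dotProduct, hz, flowGenerator_apply] using this
  have him : flowGenerator S (WithLp.toLp 2 fun l => (v l).im) =
      z.im • WithLp.toLp 2 fun l => (v l).re := by
    ext l
    have := congrArg Complex.im (congrFun hv' l)
    simpa [Matrix.mulVec, dotProduct, hz, flowGenerator_apply] using this
  refine ⟨‖WithLp.toLp 2 fun l => (v l).re‖ + ‖WithLp.toLp 2 fun l => (v l).im‖,
    fun t => ⟨norm_expFlow_le_of_rotation S hre him t, ?_⟩⟩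
  rw [add_comm]
  refine norm_expFlow_le_of_rotation (ω := -z.im) S ?_ ?_ t
  · rw [him, neg_neg]
  · rw [hre]

theorem exists_norm_expFlow_le (hS : IsSemisimpleWithImaginarySpectrum S) :
    ∃ C, 0 < C ∧ ∀ t, ‖expFlow S t‖ ≤ C := by
  obtain ⟨C, hC⟩ := banach_steinhaus (g := expFlow S) fun v => by
    have hv : (fun l => (v l : ℂ)) ∈ boundedOrbits S := by
      rw [boundedOrbits_eq_top hS]; trivial
    obtain ⟨C, hC⟩ := hv
    exact ⟨C, fun t => (hC t).1⟩
  exact ⟨max C 1, lt_max_of_lt_right one_pos, fun t => (hC t).trans (le_max_left _ _)⟩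

end

/-! ### Triggering instants -/

section
variable {N n : ℕ} {S : Matrix (Fin n) (Fin n) ℝ} {μ₁ α₁ α₂ α₃ t₀ : ℝ}
  {a : Fin n → ℝ → Matrix (Fin N) (Fin N) ℝ}
  {η : Fin N → ℝ → EuclideanSpace ℝ (Fin n)} {τ : Fin N → ℕ → EReal}

theorem auxVar_openLoop (x : ℝ → EuclideanSpace ℝ (Fin n)) (s t : ℝ) :
    auxVar S (openLoop S x s) t = auxVar S x s := by
  rw [auxVar, openLoop, auxVar, ← expFlow_add_apply]
  congr 2
  ring

theorem openLoop_sub (x : ℝ → EuclideanSpace ℝ (Fin n)) (s t : ℝ) :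
    openLoop S x s t - x t = expFlow S t (auxVar S x s - auxVar S x t) := by
  rw [map_sub, auxVar, auxVar, ← expFlow_add_apply, ← expFlow_add_apply, add_neg_cancel,
    expFlow_zero]
  rfl

theorem auxVar_sub (x : ℝ → EuclideanSpace ℝ (Fin n)) (s t : ℝ) :
    auxVar S x s - auxVar S x t = expFlow S (-t) (openLoop S x s t - x t) := by
  rw [openLoop_sub, ← expFlow_add_apply, neg_add_cancel, expFlow_zero]
  rfl

theorem continuousOn_auxVar {x : ℝ → EuclideanSpace ℝ (Fin n)} {s : Set ℝ}
    (hx : ContinuousOn x s) : ContinuousOn (auxVar S x) s :=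
  ((continuous_expFlow S).comp continuous_neg).continuousOn.clm_apply hx

namespace IsEventTriggeredObserver

theorem le_succ (h : IsEventTriggeredObserver S μ₁ α₁ α₂ α₃ t₀ a η τ) (i : Fin N) (k : ℕ) :
    τ i k ≤ τ i (k + 1) := by
  rw [h.next_trigger]
  refine le_sInf ?_
  rintro _ ⟨t, ht, rfl⟩
  exact ht.1.le

theorem monotone (h : IsEventTriggeredObserver S μ₁ α₁ α₂ α₃ t₀ a η τ) (i : Fin N) :
    Monotone (τ i) := monotone_nat_of_le_succ (h.le_succ i)

theorem coe_le (h : IsEventTriggeredObserver S μ₁ α₁ α₂ α₃ t₀ a η τ) (i : Fin N) (k : ℕ) :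
    (t₀ : EReal) ≤ τ i k := by
  rw [← h.first_trigger i]
  exact h.monotone i (Nat.zero_le k)

theorem exists_coe (h : IsEventTriggeredObserver S μ₁ α₁ α₂ α₃ t₀ a η τ) (i : Fin N) (k : ℕ)
    (hk : τ i k ≠ ⊤) : ∃ s : ℝ, t₀ ≤ s ∧ τ i k = s := by
  have h1 : τ i k ≠ ⊥ := fun h0 => by
    have := h.coe_le i k
    rw [h0] at this
    exact absurd this (by simp)
  refine ⟨(τ i k).toReal, ?_, (EReal.coe_toReal hk h1).symm⟩
  rw [← EReal.coe_le_coe_iff, EReal.coe_toReal hk h1]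
  exact h.coe_le i k

theorem lastTrigger_eq (h : IsEventTriggeredObserver S μ₁ α₁ α₂ α₃ t₀ a η τ) {i : Fin N} {k : ℕ}
    {s t : ℝ} (hs : τ i k = s) (hst : s ≤ t) (ht : (t : EReal) < τ i (k + 1)) :
    lastTrigger (τ i) t = s := by
  refine IsGreatest.csSup_eq ⟨⟨hst, k, hs⟩, ?_⟩
  rintro s' ⟨hs't, k', hk'⟩
  have hk : k' ≤ k := by
    by_contra! hlt
    have h1 := ht.trans_le (h.monotone i (Nat.succ_le_of_lt hlt))
    rw [hk', EReal.coe_lt_coe_iff] at h1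
    linarith
  have h2 := h.monotone i hk
  rwa [hk', hs, EReal.coe_le_coe_iff] at h2

/-- Before the first accumulation instant there is a latest triggering instant. -/
theorem exists_trigger_le (h : IsEventTriggeredObserver S μ₁ α₁ α₂ α₃ t₀ a η τ) (i : Fin N)
    {t : ℝ} (ht₀ : t₀ ≤ t) (ht : (t : EReal) < accumulationTime τ) :
    ∃ (k : ℕ) (s : ℝ), τ i k = s ∧ s ≤ t ∧ (t : EReal) < τ i (k + 1) := by
  have hex : ∃ k, (t : EReal) < τ i k := lt_iSup_iff.1 (ht.trans_le (iInf_le _ i))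
  classical
  have hspec := Nat.find_spec hex
  obtain ⟨k, hk⟩ : ∃ k, Nat.find hex = k + 1 := by
    refine Nat.exists_eq_succ_of_ne_zero fun h0 => ?_
    rw [h0, h.first_trigger, EReal.coe_lt_coe_iff] at hspec
    linarith
  have hle : τ i k ≤ t := not_lt.1 (Nat.find_min hex (by omega))
  obtain ⟨s, -, hs⟩ := h.exists_coe i k (ne_top_of_le_ne_top (EReal.coe_ne_top t) hle)
  refine ⟨k, s, hs, ?_, hk ▸ hspec⟩
  rwa [hs, EReal.coe_le_coe_iff] at hle

/-- Between triggering instants the error of the open-loop estimate is below the threshold. -/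
theorem norm_openLoop_sub_le (h : IsEventTriggeredObserver S μ₁ α₁ α₂ α₃ t₀ a η τ)
    (hα₁ : 0 < α₁) (hα₂ : 1 < α₂) {i : Fin N} {k : ℕ} {s t : ℝ} (ht₀ : t₀ ≤ t)
    (hs : τ i k = s) (hst : s ≤ t) (ht : (t : EReal) < τ i (k + 1)) :
    ‖openLoop S (η i) s t - η i t‖ ≤ α₁ / (t - t₀ + α₂) ^ α₃ := by
  rcases hst.eq_or_lt with rfl | hlt
  · have h0 : openLoop S (η i) s s - η i s = 0 := by rw [openLoop_sub, sub_self, map_zero]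
    rw [h0, norm_zero]
    exact div_nonneg hα₁.le (Real.rpow_nonneg (by linarith) _)
  · by_contra! hlt'
    rw [h.next_trigger] at ht
    refine absurd ht (not_lt.2 (sInf_le ⟨t, ⟨?_, ?_⟩, rfl⟩))
    · rw [hs]; exact EReal.coe_lt_coe hlt
    · rw [hs, EReal.toReal_coe]; linarith

/-- At a triggering instant the error of the open-loop estimate has reached the threshold. -/
theorem le_norm_openLoop_sub (h : IsEventTriggeredObserver S μ₁ α₁ α₂ α₃ t₀ a η τ)
    (hα₂ : 1 < α₂) {i : Fin N} {k : ℕ} {s s' : ℝ} (hs : τ i k = s)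
    (hs' : τ i (k + 1) = s') :
    α₁ / (s' - t₀ + α₂) ^ α₃ ≤ ‖openLoop S (η i) s s' - η i s'‖ := by
  have hs0 : t₀ ≤ s := by have := h.coe_le i k; rwa [hs, EReal.coe_le_coe_iff] at this
  have hss' : s ≤ s' := by have := h.le_succ i k; rwa [hs, hs', EReal.coe_le_coe_iff] at this
  set A : Set ℝ := {t : ℝ | τ i k < (t : EReal) ∧
      0 ≤ ‖openLoop S (η i) (τ i k).toReal t - η i t‖ - α₁ / (t - t₀ + α₂) ^ α₃} with hA
  have hinf : sInf ((fun t : ℝ => (t : EReal)) '' A) = s' := by rw [← hs', h.next_trigger]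
  have hAs' : ∀ t ∈ A, s' ≤ t := fun t ht => by
    have := sInf_le (mem_image_of_mem (fun t : ℝ => (t : EReal)) ht)
    rwa [hinf, EReal.coe_le_coe_iff] at this
  -- the infimum is a limit of instants at which the threshold is exceeded
  have hcl : s' ∈ closure A := by
    refine Metric.mem_closure_iff.2 fun ε hε => ?_
    have h1 : sInf ((fun t : ℝ => (t : EReal)) '' A) < ((s' + ε : ℝ) : EReal) := by
      rw [hinf]; exact EReal.coe_lt_coe (by linarith)
    obtain ⟨_, ⟨t, ht, rfl⟩, hlt⟩ := sInf_lt_iff.1 h1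
    have hlt : t < s' + ε := EReal.coe_lt_coe_iff.1 hlt
    refine ⟨t, ht, ?_⟩
    rw [dist_comm, Real.dist_eq, abs_of_nonneg (by linarith [hAs' t ht])]
    linarith
  have hpos : ∀ t ∈ Ici s', t - t₀ + α₂ ≠ 0 := fun t ht => by
    have : s' ≤ t := ht
    linarith
  have hc : ContinuousOn
      (fun t => ‖openLoop S (η i) s t - η i t‖ - α₁ / (t - t₀ + α₂) ^ α₃) (Ici s') := by
    have h1 : ContinuousOn (fun t => openLoop S (η i) s t) (Ici s') :=
      (((continuous_expFlow S).comp (continuous_id.sub continuous_const)).clm_apply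
        continuous_const).continuousOn
    have h2 : ContinuousOn (η i) (Ici s') :=
      (h.continuousOn i).mono (Ici_subset_Ici.2 (by linarith))
    refine (h1.sub h2).norm.sub (continuousOn_const.div ?_ ?_)
    · exact ContinuousOn.rpow_const (Continuous.continuousOn (by fun_prop)) fun t ht =>
        Or.inl (hpos t ht)
    · intro t ht
      have : s' ≤ t := ht
      exact (Real.rpow_pos_of_pos (by linarith) _).ne'
  have hmem := hc s' self_mem_Ici |>.mono (fun t ht => hAs' t ht : A ⊆ Ici s')
  have : (0 : ℝ) ≤ ‖openLoop S (η i) s s' - η i s'‖ - α₁ / (s' - t₀ + α₂) ^ α₃ := by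
    have : NeBot (𝓝[A] s') := mem_closure_iff_nhdsWithin_neBot.1 hcl
    refine ge_of_tendsto hmem.tendsto ?_
    filter_upwards [self_mem_nhdsWithin] with t ht
    have := ht.2
    rwa [hs, EReal.toReal_coe] at this
  linarith

/-- The sampling error of the auxiliary variable, before the first accumulation instant. -/
theorem norm_auxVarHat_sub_le (h : IsEventTriggeredObserver S μ₁ α₁ α₂ α₃ t₀ a η τ)
    (hα₁ : 0 < α₁) (hα₂ : 1 < α₂) {C : ℝ} (hC : ∀ t, ‖expFlow S t‖ ≤ C) (i : Fin N) {t : ℝ}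
    (ht₀ : t₀ ≤ t) (ht : (t : EReal) < accumulationTime τ) :
    ‖auxVarHat S (τ i) (η i) t - auxVar S (η i) t‖ ≤ C * (α₁ / (t - t₀ + α₂) ^ α₃) := by
  obtain ⟨k, s, hs, hst, htk⟩ := h.exists_trigger_le i ht₀ ht
  rw [auxVarHat, h.lastTrigger_eq hs hst htk, auxVar_openLoop, auxVar_sub]
  exact (ContinuousLinearMap.le_opNorm _ _).trans (mul_le_mul (hC _)
    (h.norm_openLoop_sub_le hα₁ hα₂ ht₀ hs hst htk) (norm_nonneg _)
    ((norm_nonneg _).trans (hC 0)))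

end IsEventTriggeredObserver
end

/-! ### The decay rate of the triggering threshold -/

/-- The shape `(t - t₀ + α₂)^{-α₃}` of the triggering threshold. -/
def thresholdDecay (t₀ α₂ α₃ t : ℝ) : ℝ := ((t - t₀ + α₂) ^ α₃)⁻¹

section
variable {t₀ α₂ α₃ : ℝ}

theorem thresholdDecay_pos (hα₂ : 1 < α₂) {t : ℝ} (ht : t₀ ≤ t) :
    0 < thresholdDecay t₀ α₂ α₃ t :=
  inv_pos.2 (Real.rpow_pos_of_pos (by linarith) _)

theorem thresholdDecay_antitoneOn (hα₂ : 1 < α₂) (hα₃ : 1 < α₃) :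
    AntitoneOn (thresholdDecay t₀ α₂ α₃) (Ici t₀) := by
  intro s hs t ht hst
  have hs : t₀ ≤ s := hs
  exact inv_anti₀ (Real.rpow_pos_of_pos (by linarith) _)
    (Real.rpow_le_rpow (by linarith) (by linarith) (by linarith))

theorem thresholdDecay_add_one (hα₂ : 1 < α₂) {s : ℝ} (hs : t₀ ≤ s) :
    thresholdDecay t₀ α₂ α₃ (s + 1) =
      (1 - (s + 1 - t₀ + α₂)⁻¹) ^ α₃ * thresholdDecay t₀ α₂ α₃ s := by
  have h1 : 0 < s - t₀ + α₂ := by linarith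
  have h2 : 0 < s + 1 - t₀ + α₂ := by linarith
  have h3 : 1 - (s + 1 - t₀ + α₂)⁻¹ = (s - t₀ + α₂) / (s + 1 - t₀ + α₂) := by
    field_simp; ring
  have h4 := (Real.rpow_pos_of_pos h1 α₃).ne'
  rw [thresholdDecay, thresholdDecay, h3, Real.div_rpow h1.le h2.le]
  field_simp

/-- The threshold decays more slowly than any exponential. -/
theorem thresholdDecay_slow (hα₂ : 1 < α₂) {ε : ℝ} (hε : 0 < ε) :
    ∃ s₁, t₀ ≤ s₁ ∧ ∀ s, s₁ ≤ s →
      (1 - ε) * thresholdDecay t₀ α₂ α₃ s ≤ thresholdDecay t₀ α₂ α₃ (s + 1) := by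
  have h1 : Tendsto (fun s : ℝ => s + 1 - t₀ + α₂) atTop atTop := by
    have : (fun s : ℝ => s + 1 - t₀ + α₂) = fun s => s + (1 - t₀ + α₂) := by ext s; ring
    rw [this]
    exact tendsto_atTop_add_const_right _ _ tendsto_id
  have h2 : Tendsto (fun s : ℝ => (1 - (s + 1 - t₀ + α₂)⁻¹) ^ α₃) atTop (𝓝 1) := by
    have h3 : Tendsto (fun s : ℝ => 1 - (s + 1 - t₀ + α₂)⁻¹) atTop (𝓝 1) := by
      simpa using tendsto_const_nhds.sub (tendsto_inv_atTop_zero.comp h1)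
    simpa using h3.rpow_const (Or.inl one_ne_zero)
  obtain ⟨s₁, hs₁⟩ := eventually_atTop.1 (h2.eventually_const_lt (show 1 - ε < 1 by linarith))
  refine ⟨max s₁ t₀, le_max_right _ _, fun s hs => ?_⟩
  have hs0 : t₀ ≤ s := (le_max_right _ _).trans hs
  rw [thresholdDecay_add_one hα₂ hs0]
  exact mul_le_mul_of_nonneg_right (hs₁ s ((le_max_left _ _).trans hs)).le
    (thresholdDecay_pos hα₂ hs0).le

theorem half_rpow_mul_thresholdDecay_le (hα₂ : 1 < α₂) (hα₃ : 1 < α₃) {s t : ℝ} (hs : t₀ ≤ s)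
    (hst : s ≤ t) (hts : t ≤ s + 1) :
    (1 / 2) ^ α₃ * thresholdDecay t₀ α₂ α₃ s ≤ thresholdDecay t₀ α₂ α₃ t := by
  refine le_trans ?_ (thresholdDecay_antitoneOn hα₂ hα₃ (mem_Ici.2 (hs.trans hst))
    (mem_Ici.2 (by linarith)) hts)
  rw [thresholdDecay_add_one hα₂ hs]
  refine mul_le_mul_of_nonneg_right (Real.rpow_le_rpow (by norm_num) ?_ (by linarith))
    (thresholdDecay_pos hα₂ hs).le
  have : (s + 1 - t₀ + α₂)⁻¹ ≤ 2⁻¹ := inv_anti₀ two_pos (by linarith)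
  linarith

theorem thresholdDecay_tendsto (hα₃ : 1 < α₃) :
    Tendsto (thresholdDecay t₀ α₂ α₃) atTop (𝓝 0) := by
  have h1 : Tendsto (fun s : ℝ => s - t₀ + α₂) atTop atTop := by
    have : (fun s : ℝ => s - t₀ + α₂) = fun s => s + (- t₀ + α₂) := by ext s; ring
    rw [this]
    exact tendsto_atTop_add_const_right _ _ tendsto_id
  exact tendsto_inv_atTop_zero.comp ((tendsto_rpow_atTop (by linarith)).comp h1)

/-- The integral of `thresholdDecay` over `[t, ∞)`. -/
def thresholdTail (t₀ α₂ α₃ t : ℝ) : ℝ := (t - t₀ + α₂) ^ (1 - α₃) / (α₃ - 1)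

theorem hasDerivAt_thresholdTail (hα₂ : 1 < α₂) (hα₃ : 1 < α₃) {t : ℝ} (ht : t₀ ≤ t) :
    HasDerivAt (thresholdTail t₀ α₂ α₃) (-thresholdDecay t₀ α₂ α₃ t) t := by
  have hpos : 0 < t - t₀ + α₂ := by linarith
  have h1 : HasDerivAt (fun t => t - t₀ + α₂) 1 t := ((hasDerivAt_id t).sub_const t₀).add_const α₂
  have h2 := (h1.rpow_const (p := 1 - α₃) (Or.inl hpos.ne')).div_const (α₃ - 1)
  refine h2.congr_deriv ?_
  have h3 : α₃ - 1 ≠ 0 := by linarith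
  rw [thresholdDecay, ← Real.rpow_neg hpos.le, show 1 - α₃ - 1 = -α₃ by ring]
  field_simp
  ring

theorem thresholdTail_nonneg (hα₂ : 1 < α₂) (hα₃ : 1 < α₃) {t : ℝ} (ht : t₀ ≤ t) :
    0 ≤ thresholdTail t₀ α₂ α₃ t :=
  div_nonneg (Real.rpow_nonneg (by linarith) _) (by linarith)

theorem thresholdTail_tendsto (hα₃ : 1 < α₃) :
    Tendsto (thresholdTail t₀ α₂ α₃) atTop (𝓝 0) := by
  have h1 : Tendsto (fun s : ℝ => s - t₀ + α₂) atTop atTop := by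
    have : (fun s : ℝ => s - t₀ + α₂) = fun s => s + (- t₀ + α₂) := by ext s; ring
    rw [this]
    exact tendsto_atTop_add_const_right _ _ tendsto_id
  have h2 := ((tendsto_rpow_neg_atTop (y := α₃ - 1) (by linarith)).comp h1).div_const (α₃ - 1)
  rw [zero_div] at h2
  refine h2.congr fun t => ?_
  simp only [Function.comp, thresholdTail, neg_sub]

end

theorem thresholdTail_sub_le {α₂ α₃ t₀ s t : ℝ} (hα₂ : 1 < α₂) (hα₃ : 1 < α₃) (hs : t₀ ≤ s)
    (hst : s ≤ t) : thresholdTail t₀ α₂ α₃ s - thresholdTail t₀ α₂ α₃ t ≤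
      thresholdDecay t₀ α₂ α₃ s * (t - s) := by
  have hd : ∀ z ∈ Icc s t, HasDerivAt (thresholdTail t₀ α₂ α₃) (-thresholdDecay t₀ α₂ α₃ z) z :=
    fun z hz => hasDerivAt_thresholdTail hα₂ hα₃ (hs.trans hz.1)
  have := abs_sub_le_of_hasDerivAt_off_countable hst
    (fun z hz => (hd z hz).continuousAt.continuousWithinAt) countable_empty
    (fun z hz _ => hd z (Ioo_subset_Icc_self hz)) (C := thresholdDecay t₀ α₂ α₃ s)
    (fun z hz _ => by
      rw [abs_neg, abs_of_pos (thresholdDecay_pos hα₂ (hs.trans hz.1.le))]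
      exact thresholdDecay_antitoneOn hα₂ hα₃ (mem_Ici.2 hs) (mem_Ici.2 (hs.trans hz.1.le)) hz.1.le)
  linarith [(abs_le.1 this).1]

theorem EuclideanSpace.norm_le_card_mul {n : ℕ} {v : EuclideanSpace ℝ (Fin n)} {c : ℝ}
    (h : ∀ l, |v l| ≤ c) : ‖v‖ ≤ n * c := by
  rw [← (EuclideanSpace.basisFun (Fin n) ℝ).sum_repr v]
  refine (norm_sum_le _ _).trans ?_
  calc _ ≤ ∑ _l : Fin n, c := Finset.sum_le_sum fun l _ => by
        rw [norm_smul, OrthonormalBasis.norm_eq_one, mul_one]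
        simpa using h l
    _ = n * c := by simp

/-- A bound by the threshold decay on the derivative of the auxiliary variable bounds its
increments. The endpoint `t` may be `T` itself. -/
theorem norm_auxVar_sub_le {n : ℕ} {S : Matrix (Fin n) (Fin n) ℝ} {α₂ α₃ t₀ K₁ : ℝ} {T : EReal}
    {x : ℝ → EuclideanSpace ℝ (Fin n)} (hα₂ : 1 < α₂) (hα₃ : 1 < α₃) {D : Set ℝ}
    (hD : D.Countable) (hx : ContinuousOn x (Ici t₀))
    (hd : ∀ t, t₀ < t → (t : EReal) < T → t ∉ D → ∀ l,
      ∃ y, HasDerivAt (fun t => auxVar S x t l) y t ∧ |y| ≤ K₁ * thresholdDecay t₀ α₂ α₃ t)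
    {s t : ℝ} (hs : t₀ ≤ s) (hst : s ≤ t) (ht : (t : EReal) ≤ T) :
    ‖auxVar S x t - auxVar S x s‖ ≤
      n * (K₁ * (thresholdTail t₀ α₂ α₃ s - thresholdTail t₀ α₂ α₃ t)) := by
  refine EuclideanSpace.norm_le_card_mul fun l => ?_
  have hex : ∀ z, ∃ y, z ∈ Ioo s t → z ∉ D → HasDerivAt (fun t => auxVar S x t l) y z ∧
      |y| ≤ K₁ * thresholdDecay t₀ α₂ α₃ z := by
    intro z
    by_cases hz : z ∈ Ioo s t ∧ z ∉ D
    · obtain ⟨y, hy⟩ := hd z (hs.trans_lt hz.1.1) ((EReal.coe_lt_coe hz.1.2).trans_le ht) hz.2 l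
      exact ⟨y, fun _ _ => hy⟩
    · exact ⟨0, fun h1 h2 => absurd ⟨h1, h2⟩ hz⟩
  choose y hy using hex
  have htail : ∀ z ∈ Icc s t, HasDerivAt (fun t => -(K₁ * thresholdTail t₀ α₂ α₃ t))
      (K₁ * thresholdDecay t₀ α₂ α₃ z) z := fun z hz =>
    ((hasDerivAt_thresholdTail hα₂ hα₃ (hs.trans hz.1)).const_mul K₁).neg.congr_deriv (by ring)
  have := abs_sub_le_sub_of_hasDerivAt_off_countable (f := fun t => auxVar S x t l) hst
    ((EuclideanSpace.proj (𝕜 := ℝ) l).continuous.comp_continuousOn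
      ((continuousOn_auxVar hx).mono fun z hz => hs.trans hz.1))
    (fun z hz => (htail z hz).continuousAt.continuousWithinAt) hD
    (fun z hz hzD => (hy z hz hzD).1) (fun z hz _ => htail z (Ioo_subset_Icc_self hz))
    (fun z hz hzD => (hy z hz hzD).2)
  refine this.trans (le_of_eq ?_)
  ring

/-! ### Estimates up to the first accumulation instant -/

namespace IsEventTriggeredObserver
variable {N n : ℕ} {S : Matrix (Fin n) (Fin n) ℝ} {μ₁ α₁ α₂ α₃ t₀ κ M : ℝ}
  {a : Fin n → ℝ → Matrix (Fin N) (Fin N) ℝ}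
  {η : Fin N → ℝ → EuclideanSpace ℝ (Fin n)} {τ : Fin N → ℕ → EReal}

/-- Up to the first accumulation instant of triggering instants, the disagreement of the agents and
the speed of the auxiliary variables decay like the threshold. -/
theorem exists_decay_bounds (h : IsEventTriggeredObserver S μ₁ α₁ α₂ α₃ t₀ a η τ)
    (hμ₁ : 0 < μ₁) (hα₁ : 0 < α₁) (hα₂ : 1 < α₂) (hα₃ : 1 < α₃)
    (ha_pc : ∀ l i j, PiecewiseContinuousFrom t₀ (fun t => a l t i j)) (hκ : 0 < κ)
    (ha_nonneg : ∀ l t, t₀ ≤ t → ∀ i j, 0 ≤ a l t i j)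
    (ha_le : ∀ l t, t₀ ≤ t → ∀ i j, a l t i j ≤ M)
    (ha_tree : ∀ l t, t₀ ≤ t → ContainsDirectedSpanningTree (edgesOfWeight κ (a l t)))
    {C : ℝ} (hC0 : 0 < C) (hC : ∀ t, ‖expFlow S t‖ ≤ C) :
    ∃ (D : Set ℝ) (K K₁ : ℝ), D.Countable ∧ 0 ≤ K ∧ 0 ≤ K₁ ∧
      (∀ t, t₀ ≤ t → (t : EReal) < accumulationTime τ → ∀ l i j,
        |auxVar S (η i) t l - auxVar S (η j) t l| ≤ K * thresholdDecay t₀ α₂ α₃ t) ∧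
      ∀ t, t₀ < t → (t : EReal) < accumulationTime τ → t ∉ D → ∀ l i,
        ∃ y, HasDerivAt (fun t => auxVar S (η i) t l) y t ∧
          |y| ≤ K₁ * thresholdDecay t₀ α₂ α₃ t := by
  choose d hd using fun l i j => (ha_pc l i j).1
  have hdc : ∀ l i j, (d l i j ∩ Ici t₀).Countable := fun l i j => by
    have : d l i j ∩ Ici t₀ ⊆ ⋃ m : ℕ, d l i j ∩ Icc t₀ m := fun t ht => by
      obtain ⟨m, hm⟩ := exists_nat_ge t
      exact mem_iUnion.2 ⟨m, ht.1, ht.2, hm⟩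
    exact (countable_iUnion fun m : ℕ => ((hd l i j).1 m).countable).mono this
  set D : Set ℝ := (⋃ (i) (k), {t : ℝ | τ i k = t}) ∪ ⋃ (l) (i) (j), d l i j ∩ Ici t₀ with hD
  have hDc : D.Countable := by
    refine (countable_iUnion fun i => countable_iUnion fun k => ?_).union
      (countable_iUnion fun l => countable_iUnion fun i => countable_iUnion fun j => hdc l i j)
    refine Set.Subsingleton.countable fun s (hs : τ i k = s) t (ht : τ i k = t) => ?_
    rwa [hs, EReal.coe_eq_coe_iff] at ht
  have hac : ∀ t, t₀ < t → t ∉ D → ∀ l i j, ContinuousAt (fun t => a l t i j) t := by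
    intro t ht htD l i j
    have : t ∉ d l i j := fun hmem => htD (Or.inr (by
      simp only [mem_iUnion]; exact ⟨l, i, j, hmem, ht.le⟩))
    exact ((hd l i j).2 t ht.le this).continuousAt (Ici_mem_nhds ht)
  have hτD : ∀ t, t ∉ D → ∀ i k, τ i k ≠ (t : EReal) := fun t htD i k hik =>
    htD (Or.inl (by simp only [mem_iUnion]; exact ⟨i, k, hik⟩))
  set θ := thresholdDecay t₀ α₂ α₃ with hθ
  set β : ℝ := N * (μ₁ * |M|) with hβ
  have hβ0 : 0 ≤ β := by positivity
  set K₀ : ℝ := β * (2 * (C * α₁)) with hK₀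
  have hK₀0 : 0 ≤ K₀ := by positivity
  have hB0 : ∀ l t, t₀ ≤ t → ∀ i j, 0 ≤ μ₁ * a l t i j := fun l t ht i j =>
    mul_nonneg hμ₁.le (ha_nonneg l t ht i j)
  have hBβ : ∀ l t, t₀ ≤ t → ∀ i, ∑ j, μ₁ * a l t i j ≤ β := fun l t ht i => by
    calc ∑ j, μ₁ * a l t i j ≤ ∑ _j : Fin N, μ₁ * |M| := Finset.sum_le_sum fun j _ =>
          mul_le_mul_of_nonneg_left ((ha_le l t ht i j).trans (le_abs_self M)) hμ₁.le
      _ = β := by simp [hβ]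
  have herr : ∀ t, t₀ ≤ t → (t : EReal) < accumulationTime τ → ∀ i l,
      |auxVarHat S (τ i) (η i) t l - auxVar S (η i) t l| ≤ C * α₁ * θ t := by
    intro t ht htT i l
    have h1 := h.norm_auxVarHat_sub_le hα₁ hα₂ hC i ht htT
    have h2 := PiLp.norm_apply_le (auxVarHat S (τ i) (η i) t - auxVar S (η i) t) l
    rw [mul_assoc]
    exact (h2.trans h1 :)
  have hsum : ∀ l t, t₀ ≤ t → ∀ (i : Fin N) (z : Fin N → ℝ) (c : ℝ), 0 ≤ c → (∀ j, |z j| ≤ c) →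
      |∑ j, μ₁ * a l t i j * z j| ≤ β * c := by
    intro l t ht i z c hc hz
    calc |∑ j, μ₁ * a l t i j * z j| ≤ ∑ j, |μ₁ * a l t i j * z j| :=
          Finset.abs_sum_le_sum_abs _ _
      _ ≤ ∑ j, μ₁ * a l t i j * c := Finset.sum_le_sum fun j _ => by
          rw [abs_mul, abs_of_nonneg (hB0 l t ht i j)]
          exact mul_le_mul_of_nonneg_left (hz j) (hB0 l t ht i j)
      _ ≤ β * c := by
          rw [← Finset.sum_mul]
          exact mul_le_mul_of_nonneg_right (hBβ l t ht i) hc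
  set x' : Fin n → Fin N → ℝ → ℝ := fun l i t => -μ₁ * ∑ j, a l t i j *
    (auxVarHat S (τ i) (η i) t l - auxVarHat S (τ j) (η j) t l) with hx'
  have hderiv : ∀ l t, t₀ < t → (t : EReal) < accumulationTime τ → t ∉ D → ∀ i,
      HasDerivAt (fun t => auxVar S (η i) t l) (x' l i t) t := by
    intro l t ht htT htD i
    have h1 := h.dynamics i t ht htT (hτD t htD) (hac t ht htD)
    have h2 := (EuclideanSpace.proj (𝕜 := ℝ) l).hasFDerivAt.comp_hasDerivAt t h1
    refine h2.congr_deriv ?_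
    simp [hx']
  have hpert : ∀ l t, t₀ < t → (t : EReal) < accumulationTime τ → ∀ i,
      |x' l i t - ∑ j, μ₁ * a l t i j * (auxVar S (η j) t l - auxVar S (η i) t l)| ≤
        K₀ * θ t := by
    intro l t ht htT i
    have h1 : x' l i t - ∑ j, μ₁ * a l t i j * (auxVar S (η j) t l - auxVar S (η i) t l) =
        ∑ j, μ₁ * a l t i j * ((auxVarHat S (τ j) (η j) t l - auxVar S (η j) t l) -
          (auxVarHat S (τ i) (η i) t l - auxVar S (η i) t l)) := by
      simp only [hx']
      rw [Finset.mul_sum, ← Finset.sum_sub_distrib]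
      exact Finset.sum_congr rfl fun j _ => by ring
    rw [h1, hK₀, mul_assoc]
    refine hsum l t ht.le i _ _ ?_ fun j => ?_
    · have := thresholdDecay_pos (α₃ := α₃) hα₂ ht.le
      positivity
    · have h2 := herr t ht.le htT j l
      have h3 := herr t ht.le htT i l
      have := abs_sub (auxVarHat S (τ j) (η j) t l - auxVar S (η j) t l)
        (auxVarHat S (τ i) (η i) t l - auxVar S (η i) t l)
      linarith
  have hspread : ∀ l, ∃ K, 0 ≤ K ∧ ∀ t, t₀ ≤ t → (t : EReal) < accumulationTime τ → ∀ i j,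
      auxVar S (η i) t l - auxVar S (η j) t l ≤ K * θ t := by
    intro l
    refine exists_spread_le_mul (x := fun i t => auxVar S (η i) t l) (x' := x' l)
      (B := fun t i j => μ₁ * a l t i j) (κ := μ₁ * κ) (mul_pos hμ₁ hκ) hK₀0
      (fun t ht => thresholdDecay_pos hα₂ ht) (thresholdDecay_antitoneOn hα₂ hα₃)
      (fun ε hε => thresholdDecay_slow hα₂ hε) hDc
      (fun i => (EuclideanSpace.proj (𝕜 := ℝ) l).continuous.comp_continuousOn
        (continuousOn_auxVar (h.continuousOn i)))
      (hderiv l) (fun t ht htD i j => continuousAt_const.mul (hac t ht htD l i j)) (hB0 l)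
      (hBβ l) (fun t ht => ?_) (fun t ht htT _ i => hpert l t ht htT i)
    obtain ⟨r, p, hrp, hm⟩ := ha_tree l t ht
    exact ⟨⟨(r, p), hm⟩, fun i hi => mul_le_mul_of_nonneg_left (hrp i hi) hμ₁.le⟩
  choose K hK0 hK using hspread
  have hKsum : ∀ t, t₀ ≤ t → (t : EReal) < accumulationTime τ → ∀ l i j,
      |auxVar S (η i) t l - auxVar S (η j) t l| ≤ (∑ l, K l) * θ t := by
    intro t ht htT l i j
    have h1 : K l * θ t ≤ (∑ l, K l) * θ t := mul_le_mul_of_nonneg_right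
      (Finset.single_le_sum (fun l _ => hK0 l) (Finset.mem_univ l)) (thresholdDecay_pos hα₂ ht).le
    exact (abs_sub_le_iff.2 ⟨hK l t ht htT i j, hK l t ht htT j i⟩).trans h1
  have hKs0 : 0 ≤ ∑ l, K l := Finset.sum_nonneg fun l _ => hK0 l
  refine ⟨D, ∑ l, K l, β * (∑ l, K l) + K₀, hDc, hKs0, by positivity, hKsum, ?_⟩
  intro t ht htT htD l i
  refine ⟨x' l i t, hderiv l t ht htT htD i, ?_⟩
  have h1 := hsum l t ht.le i (fun j => auxVar S (η j) t l - auxVar S (η i) t l) _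
    (mul_nonneg hKs0 (thresholdDecay_pos (α₃ := α₃) hα₂ ht.le).le)
    fun j => hKsum t ht.le htT l j i
  have h2 := hpert l t ht htT i
  have h3 := abs_sub_abs_le_abs_sub (x' l i t)
    (∑ j, μ₁ * a l t i j * (auxVar S (η j) t l - auxVar S (η i) t l))
  rw [add_mul, mul_assoc]
  linarith

end IsEventTriggeredObserver


/-! ### Exclusion of Zeno behaviour and convergence -/

/-- A positive lower bound for the gaps between triggering instants up to the first accumulation
instant rules out that this instant is finite. -/
theorem IsEventTriggeredObserver.accumulationTime_eq_top {N n : ℕ}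
    {S : Matrix (Fin n) (Fin n) ℝ} {μ₁ α₁ α₂ α₃ t₀ ϱ : ℝ}
    {a : Fin n → ℝ → Matrix (Fin N) (Fin N) ℝ}
    {η : Fin N → ℝ → EuclideanSpace ℝ (Fin n)} {τ : Fin N → ℕ → EReal}
    (h : IsEventTriggeredObserver S μ₁ α₁ α₂ α₃ t₀ a η τ) (hϱ : 0 < ϱ)
    (hgap : ∀ (i : Fin N) (k : ℕ) (s s' : ℝ), τ i k = s → τ i (k + 1) = s' →
      (s' : EReal) ≤ accumulationTime τ → s + ϱ ≤ s') : accumulationTime τ = ⊤ := by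
  rcases isEmpty_or_nonempty (Fin N) with hN | hN
  · exact iInf_of_empty _
  by_contra hne
  obtain ⟨i, hi⟩ := exists_eq_ciInf_of_finite (f := fun i => ⨆ k, τ i k)
  have hle : ∀ k, τ i k ≤ accumulationTime τ := fun k => (le_iSup (τ i) k).trans hi.le
  choose s hs₀ hs using fun k => h.exists_coe i k (ne_top_of_le_ne_top hne (hle k))
  have hgrow : ∀ k : ℕ, t₀ + k * ϱ ≤ s k := by
    intro k
    induction k with
    | zero => simpa using hs₀ 0
    | succ k ih =>
      have := hgap i k (s k) (s (k + 1)) (hs k) (hs (k + 1)) (hs (k + 1) ▸ hle (k + 1))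
      push_cast
      linarith
  have hbot : accumulationTime τ ≠ ⊥ := fun h0 => by
    have := hle 0
    rw [h0, hs 0] at this
    exact absurd this (by simp)
  obtain ⟨m, hm⟩ := exists_nat_gt (((accumulationTime τ).toReal - t₀) / ϱ)
  rw [div_lt_iff₀ hϱ] at hm
  have h1 := hle m
  rw [hs m, ← EReal.coe_toReal hne hbot, EReal.coe_le_coe_iff] at h1
  linarith [hgrow m]

end

theorem mainTheorem2 {N n : ℕ} (S : Matrix (Fin n) (Fin n) ℝ)
    (hS : IsSemisimpleWithImaginarySpectrum S)
    (μ₁ α₁ α₂ α₃ t₀ : ℝ) (hμ₁ : 0 < μ₁) (hα₁ : 0 < α₁) (hα₂ : 1 < α₂) (hα₃ : 1 < α₃)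
    (a : Fin n → ℝ → Matrix (Fin N) (Fin N) ℝ)
    (ha_pc : ∀ l i j, PiecewiseContinuousFrom t₀ (fun t => a l t i j))
    (κ M : ℝ) (hκ : 0 < κ)
    (ha_nonneg : ∀ l t, t₀ ≤ t → ∀ i j, 0 ≤ a l t i j)
    (ha_le : ∀ l t, t₀ ≤ t → ∀ i j, a l t i j ≤ M)
    (ha_tree : ∀ l t, t₀ ≤ t → ContainsDirectedSpanningTree (edgesOfWeight κ (a l t)))
    (η : Fin N → ℝ → EuclideanSpace ℝ (Fin n)) (τ : Fin N → ℕ → EReal)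
    (hη : IsEventTriggeredObserver S μ₁ α₁ α₂ α₃ t₀ a η τ) :
    accumulationTime τ = ⊤ ∧
    (∃ ϱ : ℝ, 0 < ϱ ∧ ∀ i k, τ i k + (ϱ : EReal) ≤ τ i (k + 1)) ∧
    (∀ i j, Tendsto (fun t => η i t - η j t) atTop (𝓝 0)) ∧
    ∃ w : EuclideanSpace ℝ (Fin n), ∀ i,
      Tendsto (auxVar S (η i)) atTop (𝓝 w) ∧
      Tendsto (fun t => η i t - expFlow S t w) atTop (𝓝 0) := by
  obtain ⟨C, hC0, hC⟩ := exists_norm_expFlow_le hS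
  obtain ⟨D, K, K₁, hD, hK0, hK₁0, hspread, hderiv⟩ := hη.exists_decay_bounds hμ₁ hα₁ hα₂ hα₃
    ha_pc hκ ha_nonneg ha_le ha_tree hC0 hC
  have hflow : ∀ t v, ‖expFlow S t v‖ ≤ C * ‖v‖ := fun t v =>
    (ContinuousLinearMap.le_opNorm _ _).trans (mul_le_mul_of_nonneg_right (hC t) (norm_nonneg v))
  have hincr : ∀ i s t, t₀ ≤ s → s ≤ t → (t : EReal) ≤ accumulationTime τ →
      ‖auxVar S (η i) t - auxVar S (η i) s‖ ≤
        n * (K₁ * (thresholdTail t₀ α₂ α₃ s - thresholdTail t₀ α₂ α₃ t)) := fun i s t hs hst ht =>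
    norm_auxVar_sub_le hα₂ hα₃ hD (hη.continuousOn i)
      (fun z hz hzT hzD l => hderiv z hz hzT hzD l i) hs hst ht
  set q : ℝ := (1 / 2) ^ α₃ with hq
  have hq0 : 0 < q := Real.rpow_pos_of_pos (by norm_num) _
  -- the speed of `W` and the threshold decay at the same rate, which makes `ϱ` uniform in time
  set ϱ : ℝ := min 1 (α₁ * q / (C * n * K₁ + 1)) with hϱ
  have hden : 0 < C * n * K₁ + 1 := by positivity
  have hϱ0 : 0 < ϱ := lt_min one_pos (by positivity)
  have hgap : ∀ (i : Fin N) (k : ℕ) (s s' : ℝ), τ i k = s → τ i (k + 1) = s' →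
      (s' : EReal) ≤ accumulationTime τ → s + ϱ ≤ s' := by
    intro i k s s' hs hs' hsT
    have hs0 : t₀ ≤ s := by
      have := hη.coe_le i k; rwa [hs, EReal.coe_le_coe_iff] at this
    have hss' : s ≤ s' := by
      have := hη.le_succ i k; rwa [hs, hs', EReal.coe_le_coe_iff] at this
    rcases le_total (s + 1) s' with h1 | h1
    · linarith [min_le_left 1 (α₁ * q / (C * n * K₁ + 1))]
    have hθ : 0 < thresholdDecay t₀ α₂ α₃ s := thresholdDecay_pos hα₂ hs0
    have h2 : α₁ * thresholdDecay t₀ α₂ α₃ s' ≤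
        ‖openLoop S (η i) s s' - η i s'‖ := by
      simpa only [thresholdDecay, div_eq_mul_inv] using hη.le_norm_openLoop_sub hα₂ hs hs'
    rw [openLoop_sub] at h2
    have h3 := hflow s' (auxVar S (η i) s - auxVar S (η i) s')
    rw [norm_sub_rev] at h3
    have h4 := mul_le_mul_of_nonneg_left (hincr i s s' hs0 hss' hsT) hC0.le
    have h5 := mul_le_mul_of_nonneg_left (thresholdTail_sub_le hα₂ hα₃ hs0 hss')
      (show 0 ≤ C * n * K₁ by positivity)
    have h6 := mul_le_mul_of_nonneg_left
      (half_rpow_mul_thresholdDecay_le hα₂ hα₃ hs0 hss' h1) hα₁.le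
    have h7 : α₁ * q * thresholdDecay t₀ α₂ α₃ s ≤
        (C * n * K₁ * (s' - s)) * thresholdDecay t₀ α₂ α₃ s := by
      rw [← hq] at h6
      linarith
    have h8 := le_of_mul_le_mul_right h7 hθ
    have h9 : α₁ * q / (C * n * K₁ + 1) ≤ s' - s := by
      rw [div_le_iff₀ hden]
      linarith
    linarith [min_le_right 1 (α₁ * q / (C * n * K₁ + 1))]
  have hT : accumulationTime τ = ⊤ := hη.accumulationTime_eq_top hϱ0 hgap
  have hltT : ∀ t : ℝ, (t : EReal) < accumulationTime τ := fun t => hT ▸ EReal.coe_lt_top t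
  have hηW : ∀ i t, η i t = expFlow S t (auxVar S (η i) t) := fun i t => by
    rw [auxVar, ← expFlow_add_apply, add_neg_cancel, expFlow_zero]; rfl
  have hdiff : ∀ i j, Tendsto (fun t => auxVar S (η i) t - auxVar S (η j) t) atTop (𝓝 0) := by
    intro i j
    have h1 : Tendsto (fun t => n * (K * thresholdDecay t₀ α₂ α₃ t)) atTop (𝓝 0) := by
      simpa using ((thresholdDecay_tendsto hα₃).const_mul K).const_mul (n : ℝ)
    refine squeeze_zero_norm' ?_ h1
    filter_upwards [eventually_ge_atTop t₀] with t ht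
    exact EuclideanSpace.norm_le_card_mul fun l => hspread t ht (hltT t) l i j
  have hflow0 : ∀ v : ℝ → EuclideanSpace ℝ (Fin n), Tendsto v atTop (𝓝 0) →
      Tendsto (fun t => expFlow S t (v t)) atTop (𝓝 0) := fun v hv =>
    squeeze_zero_norm (fun t => hflow t (v t)) (by simpa using hv.norm.const_mul C)
  have hlim : ∀ i, ∃ w, Tendsto (auxVar S (η i)) atTop (𝓝 w) := by
    intro i
    refine cauchySeq_tendsto_of_complete (Metric.cauchySeq_iff'.2 fun ε hε => ?_)
    have h1 : Tendsto (fun t => n * (K₁ * thresholdTail t₀ α₂ α₃ t)) atTop (𝓝 0) := by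
      simpa using ((thresholdTail_tendsto hα₃).const_mul K₁).const_mul (n : ℝ)
    obtain ⟨s, hsε, hs⟩ := ((h1.eventually_lt_const hε).and (eventually_ge_atTop t₀)).exists
    refine ⟨s, fun t hst => ?_⟩
    rw [dist_eq_norm]
    refine ((hincr i s t hs hst (hltT t).le).trans ?_).trans_lt hsε
    have := thresholdTail_nonneg (α₂ := α₂) (α₃ := α₃) hα₂ hα₃ (hs.trans hst)
    gcongr
    linarith
  refine ⟨hT, ⟨ϱ, hϱ0, fun i k => ?_⟩, fun i j => ?_, ?_⟩
  · rcases eq_or_ne (τ i (k + 1)) ⊤ with htop | htop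
    · rw [htop]; exact le_top
    · obtain ⟨s', -, hs'⟩ := hη.exists_coe i (k + 1) htop
      obtain ⟨s, -, hs⟩ := hη.exists_coe i k (ne_top_of_le_ne_top htop (hη.le_succ i k))
      rw [hs, hs', ← EReal.coe_add, EReal.coe_le_coe_iff]
      exact hgap i k s s' hs hs' (hltT s').le
  · refine (hflow0 _ (hdiff i j)).congr fun t => ?_
    rw [map_sub, ← hηW, ← hηW]
  · rcases isEmpty_or_nonempty (Fin N) with hN | ⟨⟨i₀⟩⟩
    · exact ⟨0, fun i => isEmptyElim i⟩
    obtain ⟨w, hw⟩ := hlim i₀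
    have hwi : ∀ i, Tendsto (auxVar S (η i)) atTop (𝓝 w) := fun i => by
      simpa using (hdiff i i₀).add hw
    refine ⟨w, fun i => ⟨hwi i, ?_⟩⟩
    have h1 : Tendsto (fun t => auxVar S (η i) t - w) atTop (𝓝 0) := by
      simpa using (hwi i).sub_const w
    refine (hflow0 _ h1).congr fun t => ?_
    rw [map_sub, ← hηW]
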